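/- Let $p>0$ and let $a:\mathbb{R}^2\to\mathbb{R}$ be admissible: $a\ge 0$; $a,\nabla a\in L^\infty(\mathbb{R}^2)$ and, if $p\le 2$, also $a,\nabla a\in L^1(\mathbb{R}^2)$ (weak gradient); $x\cdot\nabla a(x)\le 0$ for almost every $x$; and the radial limits $\tilde a(\theta)=\lim_{r\to\infty}a(r\theta)$ exist for every unit vector $\theta$ and define a continuous function on the unit circle. Let $u\in C(\mathbb{R};H^1(\mathbb{R}^2))$ be a global solution (in the sense of distributions) of \[ i\partial_t u+\Delta u=a(x)|u|^p u , \] which is not identically zero and whose orbit $\{u(t):t\in\mathbb{R}\}$ is pre-compact in $H^1(\mathbb{R}^2)$. For $t\ge 1$ and $g\in H^1(\mathbb{R}^2)$ put \[ \|g\|_{Z(t)}=\left\|\frac{t^{1/2}(x+2it\nabla)g}{(\langle t\rangle^3+|x|^3)^{1/2}}\right\|_{L^2_x(\mathbb{R}^2)},\qquad \langle t\rangle=(1+t^2)^{1/2}. \] Then there is a constant $c>0$ (which may depend on $u$) with \[ \inf_{t\ge 1}\|u(t)\|_{Z(t)}\ge c . \] In particular $\int_1^\infty\|u(t)\|_{Z(t)}^2\,\frac{dt}{t}=\infty$,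 so that $u$ violates the Morawetz bound $\int_1^\infty\|u(t)\|_{Z(t)}^2\,\frac{dt}{t}<\infty$. -/

import Mathlib

open MeasureTheory Filter Topology
open scoped ENNReal ContDiff

noncomputable section

namespace NLS

/-- The plane `ℝ²` with its Euclidean norm and Lebesgue measure. -/
abbrev Plane : Type := EuclideanSpace ℝ (Fin 2)

/-- Test functions: smooth and compactly supported. -/
def IsTest {F : Type*} [NormedAddCommGroup F] [NormedSpace ℝ F] (φ : Plane → F) : Prop :=
  ContDiff ℝ ∞ φ ∧ HasCompactSupport φ

/-- `G` is the weak gradient of `f`: both are locally integrable and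
`∫ (∂ⱼφ) f = - ∫ φ Gⱼ` for every test function `φ` and `j = 1, 2`. -/
def HasWeakGradient {𝕜 : Type*} [RCLike 𝕜] (f : Plane → 𝕜)
    (G : Plane → EuclideanSpace 𝕜 (Fin 2)) : Prop :=
  LocallyIntegrable f ∧ LocallyIntegrable G ∧
    ∀ φ : Plane → ℝ, IsTest φ → ∀ j : Fin 2,
      ∫ x, fderiv ℝ φ x (EuclideanSpace.single j 1) • f x = -∫ x, φ x • G x j

/-- Pairs (function, vector field) in `L²`, with norm `(‖f‖² + ‖G‖²)^{1/2}`. -/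
abbrev L2Pair : Type :=
  WithLp 2 (Lp ℂ 2 (volume : Measure Plane) ×
    Lp (EuclideanSpace ℂ (Fin 2)) 2 (volume : Measure Plane))

theorem IsTest.integrable_smul {E : Type*} [NormedAddCommGroup E] [NormedSpace ℝ E]
    {φ : Plane → ℝ} (hφ : IsTest φ) {f : Plane → E} (hf : LocallyIntegrable f) :
    Integrable (fun x => φ x • f x) :=
  hf.integrable_smul_left_of_hasCompactSupport hφ.1.continuous hφ.2

theorem IsTest.integrable_fderiv_smul {E : Type*} [NormedAddCommGroup E] [NormedSpace ℝ E]
    {φ : Plane → ℝ} (hφ : IsTest φ) (v : Plane) {f : Plane → E} (hf : LocallyIntegrable f) :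
    Integrable (fun x => fderiv ℝ φ x v • f x) := by
  refine hf.integrable_smul_left_of_hasCompactSupport ?_ (hφ.2.fderiv_apply ℝ v)
  exact (hφ.1.continuous_fderiv (by simp)).clm_apply continuous_const

theorem locallyIntegrable_coord {𝕜 : Type*} [RCLike 𝕜] {G : Plane → EuclideanSpace 𝕜 (Fin 2)}
    (hG : LocallyIntegrable G) (j : Fin 2) : LocallyIntegrable (fun x => G x j) := by
  intro x
  obtain ⟨s, hs, hi⟩ := hG x
  exact ⟨s, hs, (EuclideanSpace.proj (𝕜 := 𝕜) (ι := Fin 2) j).integrable_comp hi⟩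

theorem HasWeakGradient.congr {𝕜 : Type*} [RCLike 𝕜] {f f' : Plane → 𝕜}
    {G G' : Plane → EuclideanSpace 𝕜 (Fin 2)} (h : HasWeakGradient f G)
    (hf : f =ᵐ[volume] f') (hG : G =ᵐ[volume] G') : HasWeakGradient f' G' := by
  refine ⟨fun x => ?_, fun x => ?_, fun φ hφ j => ?_⟩
  · obtain ⟨s, hs, hi⟩ := h.1 x
    exact ⟨s, hs, hi.congr (ae_restrict_of_ae hf)⟩
  · obtain ⟨s, hs, hi⟩ := h.2.1 x
    exact ⟨s, hs, hi.congr (ae_restrict_of_ae hG)⟩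
  · have e := h.2.2 φ hφ j
    rw [integral_congr_ae (g := fun x => fderiv ℝ φ x (EuclideanSpace.single j 1) • f' x)
        (by filter_upwards [hf] with x hx; rw [hx]),
      integral_congr_ae (f := fun x => φ x • G x j) (g := fun x => φ x • G' x j)
        (by filter_upwards [hG] with x hx; rw [hx])] at e
    exact e

theorem HasWeakGradient.add {𝕜 : Type*} [RCLike 𝕜] {f g : Plane → 𝕜}
    {G H : Plane → EuclideanSpace 𝕜 (Fin 2)} (h : HasWeakGradient f G)
    (k : HasWeakGradient g H) : HasWeakGradient (f + g) (G + H) := by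
  refine ⟨h.1.add k.1, h.2.1.add k.2.1, fun φ hφ j => ?_⟩
  simp only [Pi.add_apply, PiLp.add_apply, smul_add]
  rw [integral_add (hφ.integrable_fderiv_smul _ h.1) (hφ.integrable_fderiv_smul _ k.1),
    integral_add (hφ.integrable_smul (locallyIntegrable_coord h.2.1 j))
      (hφ.integrable_smul (locallyIntegrable_coord k.2.1 j)),
    h.2.2 φ hφ j, k.2.2 φ hφ j]
  ring

theorem HasWeakGradient.const_smul {𝕜 : Type*} [RCLike 𝕜] {f : Plane → 𝕜}
    {G : Plane → EuclideanSpace 𝕜 (Fin 2)} (h : HasWeakGradient f G) (c : 𝕜) :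
    HasWeakGradient (c • f) (c • G) := by
  refine ⟨h.1.smul c, h.2.1.smul c, fun φ hφ j => ?_⟩
  simp only [Pi.smul_apply, PiLp.smul_apply]
  simp_rw [smul_comm _ c]
  rw [integral_smul, integral_smul, h.2.2 φ hφ j, smul_neg]

/-- The Sobolev space `H¹(ℝ²) = W^{1,2}(ℝ²; ℂ)` with the norm
`(‖f‖²_{L²} + ‖∇f‖²_{L²})^{1/2}`, realised as the space of pairs `(f, ∇f)`
(the weak gradient is determined by `f`). -/
def H1 : Submodule ℂ L2Pair where
  carrier := {w | HasWeakGradient (w.fst : Plane → ℂ) (w.snd : Plane → EuclideanSpace ℂ (Fin 2))}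
  zero_mem' := by
    have h : HasWeakGradient (fun _ : Plane => (0 : ℂ))
        (fun _ => (0 : EuclideanSpace ℂ (Fin 2))) :=
      ⟨locallyIntegrable_const 0, locallyIntegrable_const 0, fun φ _ j => by simp⟩
    exact h.congr (Lp.coeFn_zero ℂ 2 volume).symm
      (Lp.coeFn_zero (EuclideanSpace ℂ (Fin 2)) 2 volume).symm
  add_mem' := fun {v w} hv hw =>
    (HasWeakGradient.add hv hw).congr (Lp.coeFn_add v.fst w.fst).symm
      (Lp.coeFn_add v.snd w.snd).symm
  smul_mem' := fun c w hw =>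
    (HasWeakGradient.const_smul hw c).congr (Lp.coeFn_smul c w.fst).symm
      (Lp.coeFn_smul c w.snd).symm

/-- The function underlying an element of `H¹`. -/
def fn (g : H1) : Plane → ℂ := ((g : L2Pair).fst : Plane → ℂ)

/-- The weak gradient of an element of `H¹`. -/
def grad (g : H1) : Plane → EuclideanSpace ℂ (Fin 2) :=
  ((g : L2Pair).snd : Plane → EuclideanSpace ℂ (Fin 2))

/-- Admissible inhomogeneities `a` for the power `p`: `a ≥ 0`, `a, ∇a ∈ L^∞` (and also in `L¹`
if `p ≤ 2`), `x · ∇a ≤ 0`, and the radial limits of `a` exist and depend continuously on the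
direction. The gradient is the weak one, so that `x · ∇a ≤ 0` is meant almost everywhere. -/
structure Admissible (p : ℝ) (a : Plane → ℝ) : Prop where
  nonneg : ∀ x, 0 ≤ a x
  memLp_top : MemLp a ∞
  memLp_one : p ≤ 2 → MemLp a 1
  gradient : ∃ G : Plane → EuclideanSpace ℝ (Fin 2), HasWeakGradient a G ∧
    MemLp G ∞ ∧ (p ≤ 2 → MemLp G 1) ∧ ∀ᵐ x, inner ℝ x (G x) ≤ 0
  radialLimit : ∃ aInf : Metric.sphere (0 : Plane) 1 → ℝ, Continuous aInf ∧
    ∀ θ : Metric.sphere (0 : Plane) 1,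
      Tendsto (fun r : ℝ => a (r • (θ : Plane))) atTop (𝓝 (aInf θ))

/-- `u` is a global `H¹` solution of `i ∂ₜu + Δu = a |u|^p u`: it is continuous in time with
values in `H¹`, and the equation holds in the sense of distributions on `ℝ²` at every time, i.e.
`∂ₜ ∫ u φ = i (∫ u Δφ - ∫ a |u|^p u φ)` for every test function `φ`. -/
def IsSolution (p : ℝ) (a : Plane → ℝ) (u : ℝ → H1) : Prop :=
  Continuous u ∧
    ∀ φ : Plane → ℂ, IsTest φ → ∀ t : ℝ,
      HasDerivAt (fun s => ∫ x, fn (u s) x * φ x)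
        (Complex.I * ((∫ x, fn (u t) x * Laplacian.laplacian φ x) -
          ∫ x, (a x : ℂ) * ((‖fn (u t) x‖ ^ p : ℝ) : ℂ) * fn (u t) x * φ x)) t

/-- The solution has a pre-compact orbit in `H¹`. -/
def HasPrecompactOrbit (u : ℝ → H1) : Prop :=
  IsCompact (closure (Set.range u))

/-- The vector field `(x + 2it∇)g`. -/
def galilei (t : ℝ) (g : H1) (x : Plane) : EuclideanSpace ℂ (Fin 2) :=
  WithLp.toLp 2 fun j => (x j : ℂ) * fn g x + 2 * Complex.I * (t : ℂ) * grad g x j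

/-- The Japanese bracket `⟨t⟩ = (1 + t²)^{1/2}`. -/
def bracket (t : ℝ) : ℝ := Real.sqrt (1 + t ^ 2)

/-- The `Z(t)` norm
`‖ t^{1/2} (x + 2it∇)g / (⟨t⟩³ + |x|³)^{1/2} ‖_{L²}`, as an extended nonnegative number. -/
def zNorm (t : ℝ) (g : H1) : ℝ≥0∞ :=
  eLpNorm (fun x : Plane =>
    (Real.sqrt t / Real.sqrt (bracket t ^ 3 + ‖x‖ ^ 3)) • galilei t g x) 2 volume

end NLS

end

/-! Put `s = 1/t`. For `t ≥ 1` the `Z(t)` norm of `g` dominates the `L²` norm of `(s x + 2i∇)g`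
weighted by `(4 + |x|³)^{-1/2}` (`rescaledNorm_le`). The weight absorbs the factor `x`, so this
lower bound is continuous in `(s, g) ∈ [0,1] × H¹`, including `s = 0`, which stands for `t = ∞`
(`rescaledNorm_le_add`). If the `Z(t)` norms came arbitrarily close to zero, compactness of `[0,1]`
times the orbit closure would give a limit `(s, g)` with `(s x + 2i∇)g = 0`. Then `exp(-is|x|²/4) g`
has zero gradient and lies in `L²`, hence vanishes (`fn_ae_eq_zero_of_galilei`). So the limit has no
mass, which contradicts mass conservation for a nonzero solution.

Conservation of mass (`l2_fn_eq`) takes most of the work, because a distributional `H¹` solution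
cannot be tested directly against its own conjugate. The difference of localised masses at times `s`
and `t` is the real part of the pairing of `u(t) - u(s)` with `χ` times the conjugate of `u(t) +
u(s)`. The latter is mollified into a legitimate test function, and the mean value theorem in time
brings in the equation at an intermediate time, where `u(t) + u(s)` is nearly twice the solution.
The diagonal terms are real and drop out, leaving a flux controlled by `∇χ`. Shrinking the time step
and then spreading the cutoff out gives conservation. The Sobolev embedding on balls serves only to
place the nonlinearity locally in `L²`. -/

noncomputable section

namespace NLS

/-! ### Mollification and its convergence in `L²` -/

/-- The `j`-th partial derivative. -/
def pd {F : Type*} [NormedAddCommGroup F] [NormedSpace ℝ F] (j : Fin 2) (f : Plane → F)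
    (x : Plane) : F :=
  fderiv ℝ f x (EuclideanSpace.single j 1)

/-- A sequence of smooth bump functions concentrating at the origin. -/
def bump (n : ℕ) : ContDiffBump (0 : Plane) where
  rIn := 1 / ((n : ℝ) + 1)
  rOut := 2 / ((n : ℝ) + 1)
  rIn_pos := by positivity
  rIn_lt_rOut := by gcongr; norm_num

/-- The mollification of `f` at scale `2 / (n + 1)`. -/
def mollify (n : ℕ) (f : Plane → ℂ) (x : Plane) : ℂ :=
  ∫ y, (bump n).normed volume (x - y) • f y

theorem mollify_eq_convolution (n : ℕ) (f : Plane → ℂ) :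
    mollify n f = convolution f ((bump n).normed volume)
      (ContinuousLinearMap.lsmul ℝ ℝ).flip volume := rfl

theorem mollify_eq_integral_sub (n : ℕ) (f : Plane → ℂ) (x : Plane) :
    mollify n f x = ∫ y, (bump n).normed volume y • f (x - y) := by
  unfold mollify
  rw [← integral_sub_left_eq_self _ volume x]
  simp

theorem contDiff_mollify (n : ℕ) {f : Plane → ℂ} (hf : LocallyIntegrable f) :
    ContDiff ℝ ∞ (mollify n f) := by
  rw [mollify_eq_convolution]
  exact (bump n).hasCompactSupport_normed.contDiff_convolution_right _ hf
    (bump n).contDiff_normed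

/-- Mollification commutes with weak derivatives. -/
theorem pd_mollify (n : ℕ) {f : Plane → ℂ} {G : Plane → EuclideanSpace ℂ (Fin 2)}
    (h : HasWeakGradient f G) (j : Fin 2) (x : Plane) :
    pd j (mollify n f) x = mollify n (fun y => G y j) x := by
  have hd : ContDiff ℝ 1 ((bump n).normed (volume : Measure Plane)) := (bump n).contDiff_normed
  have h1 := (bump n).hasCompactSupport_normed.hasFDerivAt_convolution_right
    (ContinuousLinearMap.lsmul ℝ ℝ : ℝ →L[ℝ] ℂ →L[ℝ] ℂ).flip h.1 hd x
  unfold pd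
  rw [mollify_eq_convolution, h1.fderiv,
    convolution_precompR_apply _ h.1 ((bump n).hasCompactSupport_normed.fderiv ℝ)
      (hd.continuous_fderiv one_ne_zero)]
  set ρ := (bump n).normed (volume : Measure Plane) with hρ
  -- The reflected kernel serves as the test function; the sign from the reflection cancels the sign
  -- in the definition of the weak gradient.
  have hT : IsTest (fun y => ρ (x - y)) := by
    refine ⟨?_, ?_⟩
    · exact ((bump n).contDiff_normed (n := (⊤ : ℕ∞))).comp (contDiff_const.sub contDiff_id)
    · exact (bump n).hasCompactSupport_normed.comp_homeomorph (Homeomorph.subLeft x)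
  have h2 := h.2.2 _ hT j
  have h3 : ∀ y, fderiv ℝ (fun y => ρ (x - y)) y = - fderiv ℝ ρ (x - y) := by
    intro y
    have := ((hd.differentiable one_ne_zero) (x - y)).hasFDerivAt.comp y
      ((hasFDerivAt_const x y).sub (hasFDerivAt_id y))
    rw [show (fun y => ρ (x - y)) = ρ ∘ HSub.hSub x from rfl, this.fderiv]
    ext; simp
  simp only [h3, neg_apply, neg_smul, integral_neg, neg_inj] at h2
  exact h2

theorem lintegral_bump_normed (n : ℕ) :
    ∫⁻ y, ENNReal.ofReal ((bump n).normed (volume : Measure Plane) y) = 1 := by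
  rw [← ofReal_integral_eq_lintegral_ofReal (bump n).integrable_normed
    (Eventually.of_forall fun y => (bump n).nonneg_normed y), (bump n).integral_normed]
  simp

/-- Translations are continuous in `L²`. -/
theorem tendsto_eLpNorm_translate {f : Plane → ℂ} (hf : MemLp f 2) :
    Tendsto (fun y : Plane => eLpNorm (fun x => f (x - y) - f x) 2 volume) (𝓝 0) (𝓝 0) := by
  let g : Plane → C(Plane, Plane) := fun y => ⟨fun x => x - y, by fun_prop⟩
  have hg : Continuous g := by
    refine ContinuousMap.continuous_of_continuous_uncurry _ ?_
    simp only [Function.uncurry_def, g, ContinuousMap.coe_mk]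
    fun_prop
  have hm : ∀ y, MeasurePreserving (g y) volume volume := fun y =>
    measurePreserving_sub_right volume y
  have h1 := (continuous_const (y := hf.toLp f)).compMeasurePreservingLp hg hm
    ENNReal.ofNat_ne_top
  have h2 : Tendsto (fun y => edist (Lp.compMeasurePreserving (g y) (hm y) (hf.toLp f))
      (hf.toLp f)) (𝓝 0) (𝓝 0) := by
    have h3 := (h1.edist (continuous_const (y := hf.toLp f))).tendsto 0
    have h4 : Lp.compMeasurePreserving (g 0) (hm 0) (hf.toLp f) = hf.toLp f := by
      refine Lp.ext ?_
      refine (Lp.coeFn_compMeasurePreserving _ (hm 0)).trans ?_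
      simp [g, Function.comp_def]
    simp only [h4, edist_self] at h3
    exact h3
  refine h2.congr fun y => ?_
  rw [Lp.edist_def]
  refine eLpNorm_congr_ae ?_
  have h5 := (hm y).quasiMeasurePreserving.ae_eq_comp hf.coeFn_toLp
  filter_upwards [Lp.coeFn_compMeasurePreserving (hf.toLp f) (hm y), hf.coeFn_toLp, h5]
    with x h6 h7 h8
  simp only [Pi.sub_apply]
  rw [h6, h7, h8]
  rfl

/-- Jensen's inequality for the probability density `ρ`, obtained from Cauchy–Schwarz by splitting
`ρ` as `ρ^{1/2} · ρ^{1/2}`. -/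
theorem enorm_mollify_sub_sq_le (n : ℕ) {f : Plane → ℂ} (hf : LocallyIntegrable f) (x : Plane) :
    ‖mollify n f x - f x‖ₑ ^ 2 ≤
      ∫⁻ y, ENNReal.ofReal ((bump n).normed volume y) * ‖f (x - y) - f x‖ₑ ^ 2 := by
  set ρ := (bump n).normed (volume : Measure Plane) with hρ
  have hρm : Measurable fun y => ENNReal.ofReal (ρ y) :=
    ((bump n).continuous_normed.measurable).ennreal_ofReal
  have hfx : AEStronglyMeasurable (fun y => f (x - y)) volume :=
    hf.aestronglyMeasurable.comp_quasiMeasurePreserving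
      (quasiMeasurePreserving_sub_left volume x)
  have h1 : mollify n f x - f x = ∫ y, ρ y • (f (x - y) - f x) := by
    simp only [smul_sub]
    rw [integral_sub, ← mollify_eq_integral_sub, (bump n).integral_normed_smul]
    · have := (bump n).hasCompactSupport_normed.convolutionExists_right
        (ContinuousLinearMap.lsmul ℝ ℝ : ℝ →L[ℝ] ℂ →L[ℝ] ℂ).flip hf
        ((bump n).continuous_normed (μ := volume)) x
      have h2 := this.integrable.comp_sub_left x
      simpa [hρ] using h2
    · exact (bump n).integrable_normed.smul_const _
  have h2 : ‖mollify n f x - f x‖ₑ ≤ ∫⁻ y, ENNReal.ofReal (ρ y) * ‖f (x - y) - f x‖ₑ := by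
    rw [h1]
    refine (enorm_integral_le_lintegral_enorm _).trans (le_of_eq ?_)
    refine lintegral_congr fun y => ?_
    rw [enorm_smul, Real.enorm_eq_ofReal ((bump n).nonneg_normed y)]
  have h3 := ENNReal.lintegral_mul_le_Lp_mul_Lq volume Real.HolderConjugate.two_two
    (f := fun y => ENNReal.ofReal (ρ y) ^ (1 / 2 : ℝ))
    (g := fun y => ENNReal.ofReal (ρ y) ^ (1 / 2 : ℝ) * ‖f (x - y) - f x‖ₑ)
    (hρm.pow_const _).aemeasurable
    ((hρm.pow_const _).aemeasurable.mul (hfx.sub aestronglyMeasurable_const).enorm)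
  have hh : ∀ z : ℝ≥0∞, z ^ (1 / 2 : ℝ) * z ^ (1 / 2 : ℝ) = z := fun z => by
    rw [← ENNReal.rpow_add_of_nonneg _ _ (by norm_num) (by norm_num)]; norm_num
  have hs : ∀ z : ℝ≥0∞, (z ^ (1 / 2 : ℝ)) ^ 2 = z := fun z => by rw [pow_two, hh]
  simp only [Pi.mul_apply, ← mul_assoc, hh, ENNReal.rpow_two, mul_pow, hs] at h3
  rw [lintegral_bump_normed, ENNReal.one_rpow, one_mul] at h3
  calc _ ≤ _ := pow_le_pow_left' (h2.trans h3) 2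
    _ = _ := hs _

/-- Mollifications converge in `L²`. -/
theorem tendsto_eLpNorm_mollify_sub {f : Plane → ℂ} (hf : MemLp f 2) :
    Tendsto (fun n => eLpNorm (fun x => mollify n f x - f x) 2 volume) atTop (𝓝 0) := by
  have hloc : LocallyIntegrable f := hf.locallyIntegrable (by norm_num)
  have hsq : ∀ g : Plane → ℂ, eLpNorm g 2 volume ^ 2 = ∫⁻ x, ‖g x‖ₑ ^ 2 := fun g => by
    have := eLpNorm_nnreal_pow_eq_lintegral (f := g) (μ := volume) (p := 2) (by norm_num)
    simpa using this
  rw [ENNReal.tendsto_nhds_zero]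
  intro ε hε
  have h1 := (ENNReal.tendsto_nhds_zero.1 (tendsto_eLpNorm_translate hf)) ε hε
  obtain ⟨δ, hδ, hb⟩ := Metric.eventually_nhds_iff.1 h1
  have h2 : ∀ᶠ n : ℕ in atTop, (2 : ℝ) / (n + 1) < δ := by
    have : Tendsto (fun n : ℕ => (2 : ℝ) / (n + 1)) atTop (𝓝 0) := by
      have := (tendsto_one_div_add_atTop_nhds_zero_nat (𝕜 := ℝ)).const_mul 2
      simpa [div_eq_mul_inv, mul_comm] using this
    exact this.eventually_lt_const hδ
  filter_upwards [h2] with n hn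
  set ρ := (bump n).normed (volume : Measure Plane) with hρ
  have hρm : Measurable fun y => ENNReal.ofReal (ρ y) :=
    ((bump n).continuous_normed.measurable).ennreal_ofReal
  have hsw : AEStronglyMeasurable (fun z : Plane × Plane => f (z.1 - z.2))
      (volume.prod volume) :=
    hf.1.comp_quasiMeasurePreserving (quasiMeasurePreserving_sub_of_right_invariant volume volume)
  rw [← ENNReal.pow_le_pow_left_iff two_ne_zero, hsq]
  calc ∫⁻ x, ‖mollify n f x - f x‖ₑ ^ 2
      ≤ ∫⁻ x, ∫⁻ y, ENNReal.ofReal (ρ y) * ‖f (x - y) - f x‖ₑ ^ 2 :=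
        lintegral_mono fun x => enorm_mollify_sub_sq_le n hloc x
    _ = ∫⁻ y, ∫⁻ x, ENNReal.ofReal (ρ y) * ‖f (x - y) - f x‖ₑ ^ 2 := by
        refine lintegral_lintegral_swap ?_
        refine (hρm.comp measurable_snd).aemeasurable.mul ?_
        exact ((hsw.sub hf.1.comp_fst).enorm).pow_const 2
    _ ≤ ∫⁻ y, ENNReal.ofReal (ρ y) * ε ^ 2 := by
        refine lintegral_mono fun y => ?_
        rw [lintegral_const_mul' _ _ ENNReal.ofReal_ne_top, ← hsq (fun x => f (x - y) - f x)]
        -- Only translations by less than the outer radius, hence less than `δ`, contribute.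
        by_cases hy : ρ y = 0
        · simp [hy]
        · have hy' : y ∈ Metric.ball (0 : Plane) (bump n).rOut := by
            rw [← (bump n).support_normed_eq (μ := volume)]; exact hy
          gcongr
          exact hb (lt_trans (by simpa [bump] using hy') hn)
    _ = ε ^ 2 := by
        rw [lintegral_mul_const _ hρm, lintegral_bump_normed, one_mul]

theorem eventually_memLp_mollify {f : Plane → ℂ} (hf : MemLp f 2) :
    ∀ᶠ n in atTop, MemLp (mollify n f) 2 := by
  have h := (tendsto_eLpNorm_mollify_sub hf).eventually_lt_const (show (0 : ℝ≥0∞) < 1 by simp)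
  filter_upwards [h] with n hn
  have h1 : MemLp (fun x => mollify n f x - f x) 2 :=
    ⟨((contDiff_mollify n (hf.locallyIntegrable (by norm_num))).continuous.aestronglyMeasurable).sub
      hf.1, hn.trans (by simp)⟩
  refine (h1.add hf).ae_eq (Eventually.of_forall fun x => ?_)
  simp

/-! ### Elements of `H1` and calculus with weak gradients -/

theorem memLp_fn (g : H1) : MemLp (fn g) 2 := Lp.memLp _

theorem memLp_grad (g : H1) : MemLp (grad g) 2 := Lp.memLp _

theorem memLp_grad_coord (g : H1) (j : Fin 2) : MemLp (fun x => grad g x j) 2 :=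
  (EuclideanSpace.proj (𝕜 := ℂ) (ι := Fin 2) j).comp_memLp' (memLp_grad g)

theorem hasWeakGradient_grad (g : H1) : HasWeakGradient (fn g) (grad g) := g.2

theorem eLpNorm_fn_le (g : H1) : eLpNorm (fn g) 2 volume ≤ ENNReal.ofReal ‖g‖ := by
  have h : ‖(g : L2Pair).fst‖ ≤ ‖g‖ := WithLp.norm_fst_le _ (g : L2Pair)
  rw [Lp.norm_def] at h
  exact (ENNReal.le_ofReal_iff_toReal_le (Lp.eLpNorm_ne_top _) (norm_nonneg _)).2 h

theorem eLpNorm_grad_le (g : H1) : eLpNorm (grad g) 2 volume ≤ ENNReal.ofReal ‖g‖ := by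
  have h : ‖(g : L2Pair).snd‖ ≤ ‖g‖ := WithLp.norm_snd_le _ (g : L2Pair)
  rw [Lp.norm_def] at h
  exact (ENNReal.le_ofReal_iff_toReal_le (Lp.eLpNorm_ne_top _) (norm_nonneg _)).2 h

theorem eLpNorm_grad_coord_le (g : H1) (j : Fin 2) :
    eLpNorm (fun x => grad g x j) 2 volume ≤ ENNReal.ofReal ‖g‖ :=
  (eLpNorm_mono fun x => PiLp.norm_apply_le (grad g x) j).trans (eLpNorm_grad_le g)

theorem fn_sub (g h : H1) : fn (g - h) =ᵐ[volume] fun x => fn g x - fn h x :=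
  Lp.coeFn_sub _ _

theorem grad_sub (g h : H1) : grad (g - h) =ᵐ[volume] fun x => grad g x - grad h x :=
  Lp.coeFn_sub _ _

/-- A square integrable function on the plane with vanishing weak gradient vanishes. -/
theorem HasWeakGradient.ae_eq_zero {f : Plane → ℂ} (h : HasWeakGradient f 0) (hf : MemLp f 2) :
    f =ᵐ[volume] 0 := by
  -- Each mollification is smooth with zero derivative, hence constant, and the only constant in
  -- `L²` of a space of infinite measure is zero.
  have hz : ∀ᶠ n in atTop, mollify n f = 0 := by
    filter_upwards [eventually_memLp_mollify hf] with n hn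
    have hd : Differentiable ℝ (mollify n f) :=
      (contDiff_mollify n h.1).differentiable (by simp)
    have h0 : ∀ x, fderiv ℝ (mollify n f) x = 0 := fun x => by
      have h1 : ∀ j, fderiv ℝ (mollify n f) x (EuclideanSpace.single j 1) = 0 := fun j => by
        have := pd_mollify n h j x
        simpa [pd, mollify] using this
      refine ContinuousLinearMap.coe_injective
        ((EuclideanSpace.basisFun (Fin 2) ℝ).toBasis.ext fun j => ?_)
      simpa using h1 j
    have hc : mollify n f = fun _ => mollify n f 0 :=
      funext fun x => is_const_of_fderiv_eq_zero hd h0 x 0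
    rw [hc] at hn
    have h2 := (memLp_const_iff (by norm_num) (by norm_num)).1 hn
    rcases h2 with h2 | h2
    · rw [hc, h2]; rfl
    · simp at h2
  have h3 := tendsto_eLpNorm_mollify_sub hf
  have h4 : Tendsto (fun n => eLpNorm (fun x => mollify n f x - f x) 2 volume) atTop
      (𝓝 (eLpNorm f 2 volume)) := by
    refine tendsto_const_nhds.congr' ?_
    filter_upwards [hz] with n hn
    rw [← eLpNorm_neg]
    refine eLpNorm_congr_ae (Eventually.of_forall fun x => ?_)
    simp [hn]
  exact (eLpNorm_eq_zero_iff hf.1 (by norm_num)).1 (tendsto_nhds_unique h4 h3)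

/-- Integration by parts against complex test functions. -/
theorem HasWeakGradient.integral_pd_mul {f : Plane → ℂ} {G : Plane → EuclideanSpace ℂ (Fin 2)}
    (h : HasWeakGradient f G) {φ : Plane → ℂ} (hφ : IsTest φ) (j : Fin 2) :
    ∫ x, f x * pd j φ x = -∫ x, G x j * φ x := by
  -- Weak gradients are defined through real test functions, so the real and imaginary parts are
  -- treated separately.
  have hr : IsTest (fun x => (φ x).re) :=
    ⟨Complex.reCLM.contDiff.comp hφ.1, hφ.2.comp_left (g := Complex.re) rfl⟩
  have hi : IsTest (fun x => (φ x).im) :=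
    ⟨Complex.imCLM.contDiff.comp hφ.1, hφ.2.comp_left (g := Complex.im) rfl⟩
  have hd : ∀ x, HasFDerivAt φ (fderiv ℝ φ x) x := fun x =>
    (hφ.1.differentiable (by simp) x).hasFDerivAt
  have er : ∀ x, fderiv ℝ (fun x => (φ x).re) x (EuclideanSpace.single j 1) = (pd j φ x).re :=
    fun x => by
      have := (Complex.reCLM.hasFDerivAt.comp x (hd x)).fderiv
      exact congrArg (fun L : Plane →L[ℝ] ℝ => L (EuclideanSpace.single j 1)) this
  have ei : ∀ x, fderiv ℝ (fun x => (φ x).im) x (EuclideanSpace.single j 1) = (pd j φ x).im :=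
    fun x => by
      have := (Complex.imCLM.hasFDerivAt.comp x (hd x)).fderiv
      exact congrArg (fun L : Plane →L[ℝ] ℝ => L (EuclideanSpace.single j 1)) this
  have h1 := h.2.2 _ hr j
  have h2 := h.2.2 _ hi j
  have hG := locallyIntegrable_coord h.2.1 j
  have i1 := hr.integrable_fderiv_smul (EuclideanSpace.single j 1) h.1
  have i2 := hi.integrable_fderiv_smul (EuclideanSpace.single j 1) h.1
  simp only [er, ei] at h1 h2 i1 i2
  have key : ∀ z w : ℂ, w * z = z.re • w + Complex.I * (z.im • w) := fun z w => by
    conv_lhs => rw [← Complex.re_add_im z]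
    simp only [Complex.real_smul]; ring
  rw [integral_congr_ae (Eventually.of_forall fun x => key (pd j φ x) (f x)),
    integral_congr_ae (Eventually.of_forall fun x => key (φ x) (G x j)), integral_add i1 (i2.const_mul _),
    integral_add (hr.integrable_smul hG) ((hi.integrable_smul hG).const_mul _),
    integral_const_mul, integral_const_mul, h1, h2]
  ring

theorem pd_mul {φ ψ : Plane → ℂ} {x : Plane} (hφ : DifferentiableAt ℝ φ x)
    (hψ : DifferentiableAt ℝ ψ x) (j : Fin 2) :
    pd j (fun y => φ y * ψ y) x = pd j φ x * ψ x + φ x * pd j ψ x := by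
  unfold pd
  have := (hφ.hasFDerivAt.mul hψ.hasFDerivAt).fderiv
  rw [show (fun y => φ y * ψ y) = φ * ψ from rfl, this]
  simp [mul_comm, add_comm]

/-! ### Sobolev embedding on balls -/

theorem norm_fderiv_le_sum_pd (f : Plane → ℂ) (x : Plane) :
    ‖fderiv ℝ f x‖ ≤ ∑ j, ‖pd j f x‖ := by
  refine ContinuousLinearMap.opNorm_le_bound _ (by positivity) fun v => ?_
  have hv : v = ∑ j, v j • EuclideanSpace.single j (1 : ℝ) := by
    ext i; fin_cases i <;> simp
  conv_lhs => rw [hv]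
  rw [map_sum, Finset.sum_mul]
  refine (norm_sum_le _ _).trans (Finset.sum_le_sum fun j _ => ?_)
  rw [map_smul, norm_smul, mul_comm]
  exact mul_le_mul_of_nonneg_left (PiLp.norm_apply_le v j) (norm_nonneg _)

theorem ae_tendsto_mollify {f : Plane → ℂ} (hf : LocallyIntegrable f) :
    ∀ᵐ x, Tendsto (fun n => mollify n f x) atTop (𝓝 (f x)) := by
  have h1 : Tendsto (fun n => (bump n).rOut) atTop (𝓝 0) := by
    have := (tendsto_one_div_add_atTop_nhds_zero_nat (𝕜 := ℝ)).const_mul 2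
    simpa [div_eq_mul_inv, mul_comm, bump] using this
  have h2 := ContDiffBump.ae_convolution_tendsto_right_of_locallyIntegrable (K := 2)
    (μ := (volume : Measure Plane)) h1
    -- The outer radius is exactly twice the inner one; a uniform bound on this ratio is what almost
    -- everywhere convergence requires.
    (Eventually.of_forall fun n => by simp only [bump]; ring_nf; rfl) hf
  filter_upwards [h2] with x hx
  simp only [mollify_eq_integral_sub]
  exact hx

theorem tendsto_eLpNorm_mollify {f : Plane → ℂ} (hf : MemLp f 2) :
    Tendsto (fun n => eLpNorm f 2 volume + eLpNorm (fun x => mollify n f x - f x) 2 volume) atTop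
      (𝓝 (eLpNorm f 2 volume)) := by
  simpa using tendsto_const_nhds.add (tendsto_eLpNorm_mollify_sub hf)

theorem eLpNorm_mollify_le {f : Plane → ℂ} (hf : MemLp f 2) (n : ℕ) :
    eLpNorm (mollify n f) 2 volume ≤
      eLpNorm f 2 volume + eLpNorm (fun x => mollify n f x - f x) 2 volume := by
  have hm : AEStronglyMeasurable (mollify n f) volume :=
    (contDiff_mollify n (hf.locallyIntegrable (by norm_num))).continuous.aestronglyMeasurable
  have := eLpNorm_add_le hf.1 (hm.sub hf.1) (p := 2) (by norm_num)
  simpa using! this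

/-- A Sobolev inequality for smooth functions, localised by a cutoff. -/
theorem exists_eLpNorm_cutoff_smul_le {χ : Plane → ℝ} (hχ : IsTest χ) (q : NNReal) (hq : 2 ≤ q) :
    ∃ C : ℝ≥0∞, C ≠ ⊤ ∧ ∀ ψ : Plane → ℂ, ContDiff ℝ ∞ ψ →
      eLpNorm (fun x => χ x • ψ x) q volume ≤
        C * (eLpNorm ψ 2 volume + ∑ j, eLpNorm (pd j ψ) 2 volume) := by
  set S : Set Plane := tsupport χ
  have hS : Bornology.IsBounded S := hχ.2.isCompact.isBounded
  have hq0 : (0 : ℝ) < q := lt_of_lt_of_le (by norm_num) (show (2 : ℝ) ≤ q from hq)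
  -- The exponent with `1/r = 1/q + 1/2`, whose Sobolev conjugate in dimension two is `q`. Since `1
  -- ≤ r < 2`, Hölder's inequality on the bounded support replaces the `L^r` norm of the gradient by
  -- its `L²` norm.
  set r : NNReal := 2 * q / (q + 2) with hr
  have hr1 : 1 ≤ r := by
    rw [hr, one_le_div (by positivity)]
    calc q + 2 ≤ q + q := by gcongr
      _ = 2 * q := by ring
  have hr2 : r < 2 := by
    rw [hr, div_lt_iff₀ (by positivity), mul_add]
    exact lt_add_of_pos_right _ (by norm_num)
  have hfin : Module.finrank ℝ Plane = 2 := by simp [Plane]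
  have hrq : (r : ℝ)⁻¹ - ((Module.finrank ℝ Plane : ℕ) : ℝ)⁻¹ ≤ (q : ℝ)⁻¹ := by
    rw [hfin, hr]
    push_cast
    rw [inv_div]
    refine le_of_eq ?_
    field_simp
    ring
  obtain ⟨A, hA⟩ := hχ.2.exists_bound_of_continuous hχ.1.continuous
  obtain ⟨B, hB⟩ := (hχ.2.fderiv ℝ).exists_bound_of_continuous
    (hχ.1.continuous_fderiv (by simp))
  have hA0 : 0 ≤ A := (norm_nonneg _).trans (hA 0)
  have hB0 : 0 ≤ B := (norm_nonneg _).trans (hB 0)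
  set m : ℝ≥0∞ := (volume.restrict S) Set.univ ^ (1 / (r : ℝ≥0∞).toReal - 1 / (2 : ℝ≥0∞).toReal)
  have hm : m ≠ ⊤ := by
    refine ENNReal.rpow_ne_top_of_nonneg ?_ ?_
    · rw [sub_nonneg]
      simp only [ENNReal.coe_toReal, ENNReal.toReal_ofNat]
      exact one_div_le_one_div_of_le (lt_of_lt_of_le one_pos hr1) hr2.le
    · simpa using hχ.2.isCompact.measure_lt_top.ne
  refine ⟨eLpNormLESNormFDerivOfLeConst ℂ (volume : Measure Plane) S r q *
    (ENNReal.ofReal (A + B) * m), by finiteness, fun ψ hψ => ?_⟩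
  have hc : ContDiff ℝ ∞ (fun x => χ x • ψ x) := hχ.1.smul hψ
  have hsupp : Function.support (fun x => χ x • ψ x) ⊆ S :=
    (Function.support_smul_subset_left χ ψ).trans (subset_tsupport χ)
  have h1 := eLpNorm_le_eLpNorm_fderiv_of_le (volume : Measure Plane)
    (hc.of_le (by exact_mod_cast le_top)) hsupp hr1 (by rw [hfin]; exact_mod_cast hr2) hrq hS
  have hsupp' : Function.support (fderiv ℝ (fun x => χ x • ψ x)) ⊆ S :=
    (support_fderiv_subset ℝ).trans (closure_minimal hsupp (isClosed_tsupport χ))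
  have h2 : eLpNorm (fderiv ℝ (fun x => χ x • ψ x)) r volume ≤
      eLpNorm (fderiv ℝ (fun x => χ x • ψ x)) 2 volume * m := by
    have hres : ∀ s : ℝ≥0∞, eLpNorm (fderiv ℝ (fun x => χ x • ψ x)) s (volume.restrict S) =
        eLpNorm (fderiv ℝ (fun x => χ x • ψ x)) s volume := fun s =>
      eLpNorm_restrict_eq_of_support_subset (ε := Plane →L[ℝ] ℂ) hsupp'
    rw [← hres, ← hres]
    exact eLpNorm_le_eLpNorm_mul_rpow_measure_univ (by exact_mod_cast hr2.le)
      (hc.continuous_fderiv (by simp)).aestronglyMeasurable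
  have hψm : ∀ j, Continuous (pd j ψ) := fun j =>
    (hψ.continuous_fderiv (by simp)).clm_apply continuous_const
  have h3 : ∀ x, ‖fderiv ℝ (fun x => χ x • ψ x) x‖ ≤
      (A + B) * ‖(‖ψ x‖ + ∑ j, ‖pd j ψ x‖)‖ := fun x => by
    have hd := ((hχ.1.differentiable (by simp) x).hasFDerivAt.smul
      (hψ.differentiable (by simp) x).hasFDerivAt).fderiv
    rw [show (fun x => χ x • ψ x) = χ • ψ from rfl, hd, Real.norm_of_nonneg (by positivity)]
    refine (norm_add_le _ _).trans ?_
    rw [norm_smul, ContinuousLinearMap.norm_smulRight_apply]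
    have e1 := norm_fderiv_le_sum_pd ψ x
    have e2 : 0 ≤ ∑ j, ‖pd j ψ x‖ := by positivity
    calc _ ≤ A * ∑ j, ‖pd j ψ x‖ + B * ‖ψ x‖ := by
          gcongr
          · exact hA x
          · exact hB x
      _ ≤ _ := by nlinarith [mul_nonneg hA0 (norm_nonneg (ψ x)), mul_nonneg hB0 e2]
  have h4 : eLpNorm (fderiv ℝ (fun x => χ x • ψ x)) 2 volume ≤
      ENNReal.ofReal (A + B) * (eLpNorm ψ 2 volume + ∑ j, eLpNorm (pd j ψ) 2 volume) := by
    refine (eLpNorm_le_mul_eLpNorm_of_ae_le_mul (Eventually.of_forall h3) 2).trans ?_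
    gcongr
    refine (eLpNorm_add_le (f := fun x => ‖ψ x‖) (g := fun x => ∑ j, ‖pd j ψ x‖)
      hψ.continuous.norm.aestronglyMeasurable
      (continuous_finsetSum _ fun j _ => (hψm j).norm).aestronglyMeasurable
      (by norm_num)).trans ?_
    rw [eLpNorm_norm]
    gcongr
    have h5 := eLpNorm_sum_le (s := Finset.univ) (f := fun j x => ‖pd j ψ x‖) (μ := volume)
      (p := 2) (fun j _ => (hψm j).norm.aestronglyMeasurable) (by norm_num)
    simp only [eLpNorm_norm] at h5
    rwa [show (∑ i, fun x => ‖pd i ψ x‖) = fun x => ∑ j, ‖pd j ψ x‖ from by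
      ext x; simp] at h5
  calc _ ≤ _ := h1
    _ ≤ _ := by
      rw [mul_assoc]
      gcongr
      refine (h2.trans (mul_le_mul_left h4 m)).trans (le_of_eq ?_)
      ring

/-- The Sobolev embedding of `H¹` into `L^q` on balls, for `2 ≤ q < ∞`. -/
theorem exists_eLpNorm_ball_le (R : ℝ) (hR : 0 < R) (q : NNReal) (hq : 2 ≤ q) :
    ∃ C : ℝ≥0∞, C ≠ ⊤ ∧ ∀ g : H1,
      eLpNorm ((Metric.ball (0 : Plane) R).indicator (fn g)) q volume ≤
        C * ENNReal.ofReal ‖g‖ := by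
  let χ : ContDiffBump (0 : Plane) := ⟨R, R + 1, hR, by linarith⟩
  have hχ : IsTest (χ : Plane → ℝ) := ⟨χ.contDiff, χ.hasCompactSupport⟩
  obtain ⟨C, hC, h⟩ := exists_eLpNorm_cutoff_smul_le hχ q hq
  -- The function and its two partial derivatives each contribute one `‖g‖`.
  refine ⟨C * 3, by finiteness, fun g => ?_⟩
  have hw := hasWeakGradient_grad g
  have h1 : eLpNorm ((Metric.ball (0 : Plane) R).indicator (fn g)) q volume ≤
      eLpNorm (fun x => χ x • fn g x) q volume := by
    refine eLpNorm_mono fun x => ?_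
    by_cases hx : x ∈ Metric.ball (0 : Plane) R
    · rw [Set.indicator_of_mem hx, χ.one_of_mem_closedBall (Metric.ball_subset_closedBall hx),
        one_smul]
    · rw [Set.indicator_of_notMem hx, norm_zero]; positivity
  -- Fatou's lemma carries the smooth inequality over to the almost everywhere limit of the
  -- mollifications.
  have h2 := Lp.eLpNorm_lim_le_liminf_eLpNorm (p := (q : ℝ≥0∞)) (μ := (volume : Measure Plane))
    (f := fun n x => χ x • mollify n (fn g) x)
    (fun n => (χ.continuous.smul (contDiff_mollify n hw.1).continuous).aestronglyMeasurable)
    (fun x => χ x • fn g x)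
    (by filter_upwards [ae_tendsto_mollify hw.1] with x hx using hx.const_smul _)
  have h3 : ∀ n, eLpNorm (fun x => χ x • mollify n (fn g) x) q volume ≤
      C * ((eLpNorm (fn g) 2 volume + eLpNorm (fun x => mollify n (fn g) x - fn g x) 2 volume) +
        ∑ j, (eLpNorm (fun x => grad g x j) 2 volume +
          eLpNorm (fun x => mollify n (fun y => grad g y j) x - grad g x j) 2 volume)) := by
    intro n
    refine (h _ (contDiff_mollify n hw.1)).trans ?_
    gcongr with j
    · exact eLpNorm_mollify_le (memLp_fn g) n
    · rw [show pd j (mollify n (fn g)) = mollify n (fun y => grad g y j) from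
        funext fun x => pd_mollify n hw j x]
      exact eLpNorm_mollify_le (memLp_grad_coord g j) n
  have h4 := ENNReal.Tendsto.const_mul (a := C) ((tendsto_eLpNorm_mollify (memLp_fn g)).add
    (tendsto_finsetSum Finset.univ fun j _ => tendsto_eLpNorm_mollify (memLp_grad_coord g j)))
    (Or.inr hC)
  calc _ ≤ _ := h1
    _ ≤ _ := h2
    _ ≤ _ := liminf_le_liminf (Eventually.of_forall h3)
    _ = _ := h4.liminf_eq
    _ ≤ C * (ENNReal.ofReal ‖g‖ + ∑ _j : Fin 2, ENNReal.ofReal ‖g‖) := by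
      gcongr with j
      · exact eLpNorm_fn_le g
      · exact eLpNorm_grad_coord_le g j
    _ = _ := by
      simp only [Fin.sum_univ_two]
      ring

/-! ### Real-valued `L²` norms and the weak Laplacian -/

/-- The `L²` norm as a real number. -/
def l2 {F : Type*} [NormedAddCommGroup F] (f : Plane → F) : ℝ := (eLpNorm f 2 volume).toReal

theorem l2_nonneg {F : Type*} [NormedAddCommGroup F] (f : Plane → F) : 0 ≤ l2 f :=
  ENNReal.toReal_nonneg

theorem l2_congr {F : Type*} [NormedAddCommGroup F] {f g : Plane → F} (h : f =ᵐ[volume] g) :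
    l2 f = l2 g := by
  unfold l2; rw [eLpNorm_congr_ae h]

theorem l2_add_le {F : Type*} [NormedAddCommGroup F] {f g : Plane → F} (hf : MemLp f 2)
    (hg : MemLp g 2) : l2 (fun x => f x + g x) ≤ l2 f + l2 g := by
  unfold l2
  rw [← ENNReal.toReal_add hf.2.ne hg.2.ne]
  exact ENNReal.toReal_mono (ENNReal.add_ne_top.2 ⟨hf.2.ne, hg.2.ne⟩)
    (eLpNorm_add_le hf.1 hg.1 (by norm_num))

theorem l2_fn_le (g : H1) : l2 (fn g) ≤ ‖g‖ :=
  ENNReal.toReal_le_of_le_ofReal (norm_nonneg _) (eLpNorm_fn_le g)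

theorem l2_grad_coord_le (g : H1) (j : Fin 2) : l2 (fun x => grad g x j) ≤ ‖g‖ :=
  ENNReal.toReal_le_of_le_ofReal (norm_nonneg _) (eLpNorm_grad_coord_le g j)

theorem integrable_norm_mul_norm {f g : Plane → ℂ} (hf : MemLp f 2) (hg : MemLp g 2) :
    Integrable (fun x => ‖f x‖ * ‖g x‖) :=
  hf.norm.integrable_mul hg.norm

theorem l2_eq_rpow {f : Plane → ℂ} (hf : MemLp f 2) :
    l2 f = (∫ x, ‖f x‖ ^ (2 : ℝ)) ^ (1 / 2 : ℝ) := by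
  unfold l2
  rw [hf.eLpNorm_eq_integral_rpow_norm (by norm_num) (by norm_num)]
  simp only [ENNReal.toReal_ofNat]
  rw [ENNReal.toReal_ofReal (by positivity)]
  norm_num

theorem sq_l2 {f : Plane → ℂ} (hf : MemLp f 2) : l2 f ^ 2 = ∫ x, ‖f x‖ ^ 2 := by
  rw [l2_eq_rpow hf, ← Real.rpow_natCast, ← Real.rpow_mul (by positivity)]
  simp

/-- The Cauchy–Schwarz inequality. -/
theorem integral_norm_mul_norm_le {f g : Plane → ℂ} (hf : MemLp f 2) (hg : MemLp g 2) :
    ∫ x, ‖f x‖ * ‖g x‖ ≤ l2 f * l2 g := by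
  have h := integral_mul_norm_le_Lp_mul_Lq (μ := (volume : Measure Plane)) (f := f) (g := g)
    Real.HolderConjugate.two_two (by simpa using hf) (by simpa using hg)
  rwa [← l2_eq_rpow hf, ← l2_eq_rpow hg] at h

theorem IsTest.pd {F : Type*} [NormedAddCommGroup F] [NormedSpace ℝ F] {φ : Plane → F}
    (hφ : IsTest φ) (j : Fin 2) : IsTest (pd j φ) :=
  ⟨(hφ.1.fderiv_right (by simp)).clm_apply contDiff_const, hφ.2.fderiv_apply ℝ _⟩

theorem laplacian_eq_sum_pd {φ : Plane → ℂ} (hφ : ContDiff ℝ ∞ φ) (x : Plane) :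
    Laplacian.laplacian φ x = ∑ j, pd j (pd j φ) x := by
  rw [InnerProductSpace.laplacian_eq_iteratedFDeriv_orthonormalBasis φ
    (EuclideanSpace.basisFun (Fin 2) ℝ)]
  refine Finset.sum_congr rfl fun j _ => ?_
  have hd : DifferentiableAt ℝ (fderiv ℝ φ) x :=
    (hφ.fderiv_right (m := ∞) (by simp)).differentiable (by simp) x
  unfold pd
  rw [iteratedFDeriv_two_apply, (hd.hasFDerivAt.clm_apply (hasFDerivAt_const _ x)).fderiv]
  simp

theorem integral_fn_mul_laplacian (v : H1) {φ : Plane → ℂ} (hφ : IsTest φ) :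
    ∫ x, fn v x * Laplacian.laplacian φ x = -∑ j, ∫ x, grad v x j * pd j φ x := by
  have hw := hasWeakGradient_grad v
  simp only [laplacian_eq_sum_pd hφ.1, Finset.mul_sum]
  rw [integral_finsetSum, ← Finset.sum_neg_distrib]
  · exact Finset.sum_congr rfl fun j _ => hw.integral_pd_mul (hφ.pd j) j
  · intro j _
    have := hw.1.integrable_smul_left_of_hasCompactSupport ((hφ.pd j).pd j).1.continuous
      ((hφ.pd j).pd j).2
    simpa [mul_comm] using this

/-! ### The nonlinearity and the mass flux -/

/-- The nonlinearity `a |v|^p v`. -/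
def nonlin (p : ℝ) (a : Plane → ℝ) (v : H1) (x : Plane) : ℂ :=
  (a x : ℂ) * ((‖fn v x‖ ^ p : ℝ) : ℂ) * fn v x

/-- With `a` bounded, the local `L²` norm is controlled by the `L^{2(p+1)}` norm of `v` to the power
`p + 1`, and `2(p+1) ≥ 2` is within reach of the Sobolev embedding. The bound is uniform on bounded
sets of `H¹`; a local one suffices because the flux is always cut off. -/
theorem exists_memLp_nonlin {p : ℝ} (hp : 0 < p) {a : Plane → ℝ} (ha : MemLp a ⊤)
    {R : ℝ} (hR : 0 < R) (K : ℝ) :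
    ∃ C : ℝ, 0 ≤ C ∧ ∀ v : H1, ‖v‖ ≤ K →
      MemLp ((Metric.ball (0 : Plane) R).indicator (nonlin p a v)) 2 ∧
        l2 ((Metric.ball (0 : Plane) R).indicator (nonlin p a v)) ≤ C := by
  set q : NNReal := Real.toNNReal (2 * (p + 1))
  have hq : (q : ℝ) = 2 * (p + 1) := Real.coe_toNNReal _ (by linarith)
  obtain ⟨C, hC, h⟩ := exists_eLpNorm_ball_le R hR q
    (by rw [← NNReal.coe_le_coe]; rw [hq, NNReal.coe_ofNat]; linarith)
  set A : ℝ := (eLpNormEssSup a volume).toReal with hA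
  have hA' : ∀ᵐ x, ‖a x‖ ≤ A := by
    have h1 : eLpNormEssSup a volume ≠ ⊤ := by
      have := ha.2.ne
      rwa [eLpNorm_exponent_top] at this
    filter_upwards [enorm_ae_le_eLpNormEssSup a volume] with x hx
    have := ENNReal.toReal_mono h1 hx
    simpa using this
  set D : ℝ≥0∞ := ENNReal.ofReal A * (C * ENNReal.ofReal K) ^ (p + 1) with hD
  have hD' : D ≠ ⊤ := ENNReal.mul_ne_top ENNReal.ofReal_ne_top
    (ENNReal.rpow_ne_top_of_nonneg (by linarith) (by finiteness))
  refine ⟨D.toReal, ENNReal.toReal_nonneg, fun v hv => ?_⟩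
  set B := Metric.ball (0 : Plane) R
  have hb : ∀ᵐ x, ‖B.indicator (nonlin p a v) x‖ ≤
      A * ‖(‖B.indicator (fn v) x‖ ^ (p + 1))‖ := by
    filter_upwards [hA'] with x hx
    by_cases hxB : x ∈ B
    · simp only [Set.indicator_of_mem hxB, nonlin, norm_mul, Complex.norm_real]
      rw [Real.norm_of_nonneg (by positivity : 0 ≤ ‖fn v x‖ ^ (p + 1)),
        Real.norm_of_nonneg (by positivity : 0 ≤ ‖fn v x‖ ^ p),
        Real.rpow_add_one' (norm_nonneg _) (by linarith), mul_assoc]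
      gcongr
    · simp only [Set.indicator_of_notMem hxB, norm_zero]
      positivity
  have h1 : eLpNorm (B.indicator (nonlin p a v)) 2 volume ≤ D := by
    refine (eLpNorm_le_mul_eLpNorm_of_ae_le_mul hb 2).trans ?_
    rw [eLpNorm_norm_rpow _ (by linarith)]
    have h2 : (2 : ℝ≥0∞) * ENNReal.ofReal (p + 1) = (q : ℝ≥0∞) := by
      rw [← ENNReal.ofReal_coe_nnreal, hq, ENNReal.ofReal_mul (by norm_num)]
      simp
    rw [h2, hD]
    gcongr
    exact (h v).trans (by gcongr)
  have hfm := (memLp_fn v).1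
  have hm : AEStronglyMeasurable (nonlin p a v) volume := by
    refine AEStronglyMeasurable.mul (AEStronglyMeasurable.mul ?_ ?_) hfm
    · exact Complex.continuous_ofReal.comp_aestronglyMeasurable ha.1
    · exact Complex.continuous_ofReal.comp_aestronglyMeasurable
        ((Real.continuous_rpow_const hp.le).comp_aestronglyMeasurable hfm.norm)
  exact ⟨⟨hm.indicator Metric.isOpen_ball.measurableSet, h1.trans_lt hD'.lt_top⟩,
    ENNReal.toReal_mono hD' h1⟩

theorem pd_cutoff_mul_conj {χ : Plane → ℝ} (hχ : ContDiff ℝ ∞ χ) {ψ : Plane → ℂ}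
    (hψ : ContDiff ℝ ∞ ψ) (j : Fin 2) (x : Plane) :
    pd j (fun y => (χ y : ℂ) * star (ψ y)) x =
      ((pd j χ x : ℝ) : ℂ) * star (ψ x) + χ x * star (pd j ψ x) := by
  have h1 : HasFDerivAt (fun y => (χ y : ℂ)) (Complex.ofRealCLM.comp (fderiv ℝ χ x)) x :=
    Complex.ofRealCLM.hasFDerivAt.comp x (hχ.differentiable (by simp) x).hasFDerivAt
  have h2 : HasFDerivAt (fun y => star (ψ y))
      ((Complex.conjCLE : ℂ →L[ℝ] ℂ).comp (fderiv ℝ ψ x)) x :=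
    (Complex.conjCLE : ℂ →L[ℝ] ℂ).hasFDerivAt.comp x (hψ.differentiable (by simp) x).hasFDerivAt
  rw [pd_mul h1.differentiableAt h2.differentiableAt]
  unfold pd
  rw [h1.fderiv, h2.fderiv]
  rfl

theorem isTest_cutoff_mul_conj {χ : Plane → ℝ} (hχ : IsTest χ) {ψ : Plane → ℂ}
    (hψ : ContDiff ℝ ∞ ψ) : IsTest (fun y => (χ y : ℂ) * star (ψ y)) := by
  refine ⟨(Complex.ofRealCLM.contDiff.comp hχ.1).mul
    ((Complex.conjCLE : ℂ →L[ℝ] ℂ).contDiff.comp hψ), ?_⟩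
  exact (hχ.2.comp_left (g := fun r : ℝ => (r : ℂ)) (by simp)).mul_right

theorem abs_im_integral_le {F : Plane → ℂ} (hF : Integrable F) {b : Plane → ℝ}
    (hb : Integrable b) (h : ∀ x, |(F x).im| ≤ b x) : |(∫ x, F x).im| ≤ ∫ x, b x := by
  have h1 : (∫ x, F x).im = ∫ x, (F x).im := (Complex.imCLM.integral_comp_comm hF).symm
  rw [h1]
  exact (abs_integral_le_integral_abs).trans
    (integral_mono (hF.im.abs) hb h)

theorem memLp_cutoff_mul {χ : Plane → ℝ} (hχ : Continuous χ) {A : ℝ} (hA : ∀ x, ‖χ x‖ ≤ A)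
    {f : Plane → ℂ} (hf : MemLp f 2) : MemLp (fun x => (χ x : ℂ) * f x) 2 := by
  refine hf.of_le_mul (c := A)
    ((Complex.continuous_ofReal.comp hχ).aestronglyMeasurable.mul hf.1)
    (Eventually.of_forall fun x => ?_)
  rw [norm_mul, Complex.norm_real]
  exact mul_le_mul_of_nonneg_right (hA x) (norm_nonneg _)

theorem integrable_mul_star {f g : Plane → ℂ} (hf : MemLp f 2) (hg : MemLp g 2) :
    Integrable (fun x => f x * star (g x)) :=
  hf.integrable_mul hg.star

/-- The gradient part of the mass flux through a cutoff `χ`, tested against a function close to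
`2 v`. -/
theorem abs_im_integral_grad_le {χ : Plane → ℝ} (hχ : IsTest χ) {A L : ℝ}
    (hA : ∀ x, ‖χ x‖ ≤ A) (hL : ∀ j x, ‖pd j χ x‖ ≤ L) (v : H1) {ψ : Plane → ℂ}
    (hψ : ContDiff ℝ ∞ ψ) (hψ2 : MemLp ψ 2) (j : Fin 2) (hdψ : MemLp (pd j ψ) 2) :
    |(∫ x, grad v x j * pd j (fun y => (χ y : ℂ) * star (ψ y)) x).im| ≤
      L * (‖v‖ * l2 ψ) + A * (‖v‖ * l2 (fun x => pd j ψ x - 2 * grad v x j)) := by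
  have hA0 : 0 ≤ A := (norm_nonneg _).trans (hA 0)
  have hL0 : 0 ≤ L := (norm_nonneg _).trans (hL 0 0)
  have hg := memLp_grad_coord v j
  have hD : MemLp (fun x => pd j ψ x - 2 * grad v x j) 2 := hdψ.sub (hg.const_mul 2)
  have i1 := (integrable_norm_mul_norm hg hψ2).const_mul L
  have i2 := (integrable_norm_mul_norm hg hD).const_mul A
  have e : ∀ x, grad v x j * pd j (fun y => (χ y : ℂ) * star (ψ y)) x =
      (((pd j χ x : ℝ) : ℂ) * grad v x j) * star (ψ x) +
        ((χ x : ℂ) * grad v x j) * star (pd j ψ x) := fun x => by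
    rw [pd_cutoff_mul_conj hχ.1 hψ]; ring
  simp only [e]
  refine (abs_im_integral_le (b := fun x => L * (‖grad v x j‖ * ‖ψ x‖) +
    A * (‖grad v x j‖ * ‖pd j ψ x - 2 * grad v x j‖)) ?_ (i1.add i2) fun x => ?_).trans ?_
  · exact (integrable_mul_star (memLp_cutoff_mul (hχ.pd j).1.continuous (hL j) hg) hψ2).add
      (integrable_mul_star (memLp_cutoff_mul hχ.1.continuous hA hg) hdψ)
  · set G := grad v x j
    -- Subtracting `2G` from `∂ⱼψ` changes the product only by the real number `2χ|G|²`, invisible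
    -- to the imaginary part.
    have e2 : ((χ x : ℂ) * G * star (pd j ψ x)).im =
        ((χ x : ℂ) * G * star (pd j ψ x - 2 * G)).im := by
      have : (χ x : ℂ) * G * star (pd j ψ x - 2 * G) =
          (χ x : ℂ) * G * star (pd j ψ x) - ((χ x * 2 * ‖G‖ ^ 2 : ℝ) : ℂ) := by
        have h3 : G * star G = ((‖G‖ ^ 2 : ℝ) : ℂ) := by
          rw [Complex.ofReal_pow]; exact Complex.mul_conj' G
        rw [Complex.ofReal_mul, ← h3]
        simp only [star_sub, star_mul', star_ofNat, Complex.ofReal_mul, Complex.ofReal_ofNat]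
        ring
      rw [this, Complex.sub_im, Complex.ofReal_im, sub_zero]
    rw [Complex.add_im, e2]
    refine (abs_add_le _ _).trans (add_le_add ?_ ?_)
    · refine (Complex.abs_im_le_norm _).trans ?_
      rw [norm_mul, norm_mul, Complex.norm_real, norm_star, mul_assoc]
      exact mul_le_mul_of_nonneg_right (hL j x) (by positivity)
    · refine (Complex.abs_im_le_norm _).trans ?_
      rw [norm_mul, norm_mul, Complex.norm_real, norm_star, mul_assoc]
      exact mul_le_mul_of_nonneg_right (hA x) (by positivity)
  · rw [integral_add i1 i2, integral_const_mul, integral_const_mul]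
    have b1 := integral_norm_mul_norm_le hg hψ2
    have b2 := integral_norm_mul_norm_le hg hD
    have b3 := l2_grad_coord_le v j
    gcongr
    · exact b1.trans (mul_le_mul_of_nonneg_right b3 (l2_nonneg _))
    · exact b2.trans (mul_le_mul_of_nonneg_right b3 (l2_nonneg _))

/-- The nonlinear part of the mass flux, tested against a function close to `2 v`. -/
theorem abs_im_integral_nonlin_le {p : ℝ} {a : Plane → ℝ} {χ : Plane → ℝ} (hχ : IsTest χ)
    {A R : ℝ} (hA : ∀ x, ‖χ x‖ ≤ A) (hR : ∀ x, χ x ≠ 0 → x ∈ Metric.ball (0 : Plane) R)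
    (v : H1) (hN : MemLp ((Metric.ball (0 : Plane) R).indicator (nonlin p a v)) 2)
    {ψ : Plane → ℂ} (hψ2 : MemLp ψ 2) :
    |(∫ x, nonlin p a v x * ((χ x : ℂ) * star (ψ x))).im| ≤
      A * (l2 ((Metric.ball (0 : Plane) R).indicator (nonlin p a v)) *
        l2 (fun x => ψ x - 2 * fn v x)) := by
  have hA0 : 0 ≤ A := (norm_nonneg _).trans (hA 0)
  set N := (Metric.ball (0 : Plane) R).indicator (nonlin p a v) with hNdef
  have hD : MemLp (fun x => ψ x - 2 * fn v x) 2 := hψ2.sub ((memLp_fn v).const_mul 2)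
  have i1 := (integrable_norm_mul_norm hN hD).const_mul A
  have e : ∀ x, nonlin p a v x * ((χ x : ℂ) * star (ψ x)) = ((χ x : ℂ) * N x) * star (ψ x) :=
    fun x => by
      by_cases h0 : χ x = 0
      · simp [h0]
      · rw [hNdef, Set.indicator_of_mem (hR x h0)]; ring
  simp only [e]
  refine (abs_im_integral_le (integrable_mul_star
    (memLp_cutoff_mul hχ.1.continuous hA hN) hψ2) i1 fun x => ?_).trans ?_
  -- The same cancellation: `N` times the conjugate of `v` is real, because the nonlinearity is a
  -- real multiple of `v`.
  · have e2 : ((χ x : ℂ) * N x * star (ψ x)).im =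
        ((χ x : ℂ) * N x * star (ψ x - 2 * fn v x)).im := by
      obtain ⟨r, hr⟩ : ∃ r : ℝ, N x * star (fn v x) = (r : ℂ) := by
        by_cases hx : x ∈ Metric.ball (0 : Plane) R
        · refine ⟨a x * ‖fn v x‖ ^ p * ‖fn v x‖ ^ 2, ?_⟩
          have h3 : fn v x * star (fn v x) = ((‖fn v x‖ ^ 2 : ℝ) : ℂ) := by
            rw [Complex.ofReal_pow]; exact Complex.mul_conj' _
          rw [hNdef, Set.indicator_of_mem hx, nonlin, mul_assoc, h3]
          push_cast; ring
        · exact ⟨0, by rw [hNdef, Set.indicator_of_notMem hx]; simp⟩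
      have : (χ x : ℂ) * N x * star (ψ x - 2 * fn v x) =
          (χ x : ℂ) * N x * star (ψ x) - ((χ x * 2 * r : ℝ) : ℂ) := by
        rw [Complex.ofReal_mul, ← hr]
        simp only [star_sub, star_mul', star_ofNat, Complex.ofReal_mul, Complex.ofReal_ofNat]
        ring
      rw [this, Complex.sub_im, Complex.ofReal_im, sub_zero]
    rw [e2]
    refine (Complex.abs_im_le_norm _).trans ?_
    rw [norm_mul, norm_mul, Complex.norm_real, norm_star, mul_assoc]
    exact mul_le_mul_of_nonneg_right (hA x) (by positivity)
  · rw [integral_const_mul]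
    exact mul_le_mul_of_nonneg_left (integral_norm_mul_norm_le hN hD) hA0

/-! ### Variation of the localised mass in time -/

/-- All right slopes of `F` and of `-F` have upper limit at most `A`, so the mean value inequality
for right slopes applies to both. This removes the errors that are small only on short time
intervals. -/
theorem abs_sub_le_of_locally_almost_lipschitz {F : ℝ → ℝ} {A : ℝ}
    (h : ∀ t₀, ∀ ε > 0, ∃ δ > 0, ∀ s t, |s - t₀| < δ → |t - t₀| < δ → s < t →
      |F t - F s| ≤ (A + ε) * (t - s)) {s t : ℝ} (hst : s ≤ t) : |F t - F s| ≤ A * (t - s) := by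
  have hb : ∀ x, ∀ ε > 0, ∀ᶠ z in 𝓝[>] x, |F z - F x| ≤ (A + ε) * (z - x) := by
    intro x ε hε
    obtain ⟨δ, hδ, H⟩ := h x ε hε
    have : Set.Ioo x (x + δ) ∈ 𝓝[>] x := Ioo_mem_nhdsGT (by linarith)
    filter_upwards [this] with z hz
    refine H x z (by simpa using hδ) ?_ hz.1
    rw [abs_lt]; constructor <;> linarith [hz.1, hz.2]
  have hc : Continuous F := by
    refine continuous_iff_continuousAt.2 fun t₀ => ?_
    obtain ⟨δ, hδ, H⟩ := h t₀ 1 one_pos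
    refine Metric.continuousAt_iff.2 fun ε hε => ?_
    -- The sign of `A` is not known; `|A| + 2` is positive and dominates `A + 1`.
    refine ⟨min δ (ε / (|A| + 2)), by positivity, fun {x} hx => ?_⟩
    rw [Real.dist_eq] at hx ⊢
    have hx1 := hx.trans_le (min_le_left _ _)
    have hx2 := hx.trans_le (min_le_right _ _)
    have h0 : |t₀ - t₀| < δ := by simpa using hδ
    have hAx : |F x - F t₀| ≤ (|A| + 2) * |x - t₀| := by
      rcases lt_trichotomy x t₀ with hlt | heq | hgt
      · have := H x t₀ hx1 h0 hlt
        rw [abs_sub_comm] at this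
        rw [abs_sub_comm x, abs_of_pos (sub_pos.2 hlt)]
        exact this.trans (mul_le_mul_of_nonneg_right (by linarith [le_abs_self A]) (by linarith))
      · simp [heq]
      · have := H t₀ x h0 hx1 hgt
        rw [abs_of_pos (sub_pos.2 hgt)]
        exact this.trans (mul_le_mul_of_nonneg_right (by linarith [le_abs_self A]) (by linarith))
    refine hAx.trans_lt ?_
    rwa [lt_div_iff₀ (by positivity), mul_comm] at hx2
  have key : ∀ G : ℝ → ℝ, Continuous G →
      (∀ x, ∀ ε > 0, ∀ᶠ z in 𝓝[>] x, G z - G x ≤ (A + ε) * (z - x)) →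
      G t - G s ≤ A * (t - s) := by
    intro G hG hGb
    have := image_le_of_liminf_slope_right_le_deriv_boundary (f := G) (a := s) (b := t)
      (B := fun x => G s + A * (x - s)) (B' := fun _ => A) hG.continuousOn (by simp)
      (by fun_prop) (fun x _ => by
        have := (((hasDerivAt_id x).sub_const s).const_mul A).const_add (G s)
        simpa using this.hasDerivWithinAt)
      (fun x _ r hr => by
        have h1 := hGb x ((r - A) / 2) (by linarith)
        refine Eventually.frequently ?_
        filter_upwards [h1, self_mem_nhdsWithin] with z hz hxz
        have hxz' : 0 < z - x := sub_pos.2 hxz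
        rw [slope_def_field, div_lt_iff₀ hxz']
        nlinarith) (x := t) ⟨hst, le_rfl⟩
    linarith
  rw [abs_le]
  constructor
  · have := key (fun x => -F x) hc.neg fun x ε hε => by
      filter_upwards [hb x ε hε] with z hz
      linarith [(abs_le.1 hz).1]
    linarith
  · exact key F hc fun x ε hε => by
      filter_upwards [hb x ε hε] with z hz using (abs_le.1 hz).2

/-- The mass localised by a cutoff `χ`. -/
def localMass (χ : Plane → ℝ) (g : H1) : ℝ := ∫ x, χ x * ‖fn g x‖ ^ 2

theorem l2_le_add_two_mul {ψ : Plane → ℂ} (hψ : MemLp ψ 2) (v : H1) :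
    l2 ψ ≤ l2 (fun x => ψ x - 2 * fn v x) + 2 * ‖v‖ := by
  have hv := memLp_fn v
  have h1 := l2_add_le (hψ.sub (hv.const_mul 2)) (hv.const_mul 2)
  have h2 := l2_add_le hv hv
  have h3 := l2_fn_le v
  simp only [Pi.sub_apply, sub_add_cancel] at h1
  have h4 : (fun x => fn v x + fn v x) = fun x => 2 * fn v x := by ext; ring
  rw [h4] at h2
  exact h1.trans (add_le_add le_rfl (by linarith))

/-- The time derivative of the pairing of a solution with `χ conj ψ` is controlled by the gradient
of `χ`, up to the `H¹` distance of `ψ` to twice the solution. -/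
theorem exists_abs_flux_le {p : ℝ} (hp : 0 < p) {a : Plane → ℝ} (ha : MemLp a ⊤)
    {χ : Plane → ℝ} (hχ : IsTest χ) {L : ℝ} (hL : ∀ j x, ‖pd j χ x‖ ≤ L) {K : ℝ} (hK : 0 ≤ K) :
    ∃ C : ℝ, 0 ≤ C ∧ ∀ v : H1, ‖v‖ ≤ K → ∀ ψ : Plane → ℂ, ContDiff ℝ ∞ ψ → MemLp ψ 2 →
      (∀ j, MemLp (pd j ψ) 2) → ∀ ε : ℝ, l2 (fun x => ψ x - 2 * fn v x) ≤ ε →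
      (∀ j, l2 (fun x => pd j ψ x - 2 * grad v x j) ≤ ε) →
      |(Complex.I * ((∫ x, fn v x *
          Laplacian.laplacian (fun y => (χ y : ℂ) * star (ψ y)) x) -
        ∫ x, nonlin p a v x * ((χ x : ℂ) * star (ψ x)))).re| ≤ 4 * L * K ^ 2 + C * ε := by
  obtain ⟨A, hA⟩ := hχ.2.exists_bound_of_continuous hχ.1.continuous
  obtain ⟨R, hR0, hR⟩ : ∃ R > 0, ∀ x, χ x ≠ 0 → x ∈ Metric.ball (0 : Plane) R := by
    obtain ⟨R, hR⟩ := hχ.2.isCompact.isBounded.subset_ball (0 : Plane)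
    exact ⟨max R 1, by positivity, fun x hx =>
      Metric.ball_subset_ball (le_max_left _ _) (hR (subset_tsupport χ hx))⟩
  obtain ⟨N, hN0, hN⟩ := exists_memLp_nonlin hp ha hR0 K
  have hA0 : 0 ≤ A := (norm_nonneg _).trans (hA 0)
  have hL0 : 0 ≤ L := (norm_nonneg _).trans (hL 0 0)
  -- Each of the two coordinates gives `L K (ε + 2K) + A K ε`, because `l2 ψ ≤ ε + 2K`, and the
  -- nonlinearity gives `A N ε`. The part free of `ε` is `4 L K²`.
  refine ⟨2 * L * K + 2 * A * K + A * N, by positivity, fun v hv ψ hψ hψ2 hdψ ε h0 h1 => ?_⟩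
  have hε : 0 ≤ ε := (l2_nonneg _).trans h0
  rw [integral_fn_mul_laplacian v (isTest_cutoff_mul_conj hχ hψ), Complex.I_mul_re, abs_neg,
    Complex.sub_im, Complex.neg_im, Fin.sum_univ_two, Complex.add_im]
  have g : ∀ j, |(∫ x, grad v x j * pd j (fun y => (χ y : ℂ) * star (ψ y)) x).im| ≤
      L * (K * (ε + 2 * K)) + A * (K * ε) := fun j => by
    refine (abs_im_integral_grad_le hχ hA hL v hψ hψ2 j (hdψ j)).trans ?_
    have := l2_le_add_two_mul hψ2 v
    have h2 : l2 ψ ≤ ε + 2 * K := by linarith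
    have := h1 j
    have := l2_nonneg ψ
    have := l2_nonneg (fun x => pd j ψ x - 2 * grad v x j)
    gcongr
  have n : |(∫ x, nonlin p a v x * ((χ x : ℂ) * star (ψ x))).im| ≤ A * (N * ε) := by
    refine (abs_im_integral_nonlin_le hχ hA hR v (hN v hv).1 hψ2).trans ?_
    have := (hN v hv).2
    have := l2_nonneg (fun x => ψ x - 2 * fn v x)
    gcongr
  have g0 := abs_le.1 (g 0)
  have g1 := abs_le.1 (g 1)
  have n0 := abs_le.1 n
  rw [abs_le]
  constructor <;> nlinarith

/-- Polarisation: the real part of `(z - w)` times the conjugate of `z + w` is `|z|² - |w|²`. The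
quadratic mass difference becomes a difference of linear pairings with one fixed function, the form
to which the equation applies. -/
theorem re_integral_sub_mul_star {χ : Plane → ℝ} (hχ : IsTest χ) (g h : H1) :
    (∫ x, (fn g x - fn h x) * ((χ x : ℂ) * star (fn g x + fn h x))).re =
      localMass χ g - localMass χ h := by
  obtain ⟨A, hA⟩ := hχ.2.exists_bound_of_continuous hχ.1.continuous
  have hg := memLp_fn g
  have hh := memLp_fn h
  have hi : ∀ v : H1, Integrable (fun x => χ x * ‖fn v x‖ ^ 2) := fun v => by
    refine ((memLp_fn v).integrable_norm_pow (by norm_num)).bdd_mul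
      hχ.1.continuous.aestronglyMeasurable (Eventually.of_forall hA)
  have e : ∀ x, (fn g x - fn h x) * ((χ x : ℂ) * star (fn g x + fn h x)) =
      ((χ x : ℂ) * (fn g x - fn h x)) * star (fn g x + fn h x) := fun x => by ring
  have hF : Integrable (fun x => (fn g x - fn h x) * ((χ x : ℂ) * star (fn g x + fn h x))) := by
    simp only [e]
    exact integrable_mul_star (memLp_cutoff_mul hχ.1.continuous hA (hg.sub hh)) (hg.add hh)
  have h1 : (∫ x, (fn g x - fn h x) * ((χ x : ℂ) * star (fn g x + fn h x))).re =
      ∫ x, ((fn g x - fn h x) * ((χ x : ℂ) * star (fn g x + fn h x))).re :=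
    (Complex.reCLM.integral_comp_comm hF).symm
  rw [h1, localMass, localMass, ← integral_sub (hi g) (hi h)]
  refine integral_congr_ae (Eventually.of_forall fun x => ?_)
  simp only [← Complex.normSq_eq_norm_sq, Complex.normSq_apply]
  simp only [Complex.star_def, Complex.mul_re, Complex.mul_im, Complex.sub_re, Complex.sub_im,
    Complex.conj_re, Complex.conj_im, Complex.add_re, Complex.add_im, Complex.ofReal_re,
    Complex.ofReal_im]
  ring

theorem tendsto_l2_mollify_sub {f : Plane → ℂ} (hf : MemLp f 2) :
    Tendsto (fun n => l2 (fun x => mollify n f x - f x)) atTop (𝓝 0) :=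
  (ENNReal.tendsto_toReal ENNReal.zero_ne_top).comp (tendsto_eLpNorm_mollify_sub hf)

/-- Convergence of the pairing with mollified functions. -/
theorem tendsto_integral_mul_mollify {χ : Plane → ℝ} (hχ : IsTest χ) {f g : Plane → ℂ}
    (hf : MemLp f 2) (hg : MemLp g 2) :
    Tendsto (fun n => ∫ x, f x * ((χ x : ℂ) * star (mollify n g x))) atTop
      (𝓝 (∫ x, f x * ((χ x : ℂ) * star (g x)))) := by
  obtain ⟨A, hA⟩ := hχ.2.exists_bound_of_continuous hχ.1.continuous
  have hc := memLp_cutoff_mul hχ.1.continuous hA hf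
  have e : ∀ (k : Plane → ℂ) x, f x * ((χ x : ℂ) * star (k x)) =
      ((χ x : ℂ) * f x) * star (k x) := fun k x => by ring
  simp only [e]
  rw [tendsto_iff_norm_sub_tendsto_zero]
  have h0 : Tendsto (fun n => l2 (fun x => (χ x : ℂ) * f x) *
      l2 (fun x => mollify n g x - g x)) atTop (𝓝 0) := by
    simpa using (tendsto_l2_mollify_sub hg).const_mul (l2 (fun x => (χ x : ℂ) * f x))
  refine squeeze_zero' (Eventually.of_forall fun n => norm_nonneg _) ?_ h0
  filter_upwards [eventually_memLp_mollify hg] with n hn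
  rw [← integral_sub (integrable_mul_star hc hn) (integrable_mul_star hc hg)]
  refine (norm_integral_le_integral_norm _).trans (le_trans (le_of_eq ?_)
    (integral_norm_mul_norm_le hc (hn.sub hg)))
  refine integral_congr_ae (Eventually.of_forall fun x => ?_)
  change ‖_ - _‖ = _ * ‖mollify n g x - g x‖
  rw [← mul_sub, ← star_sub, norm_mul, norm_star]

theorem l2_mollify_sub_two_mul_le {f g h : Plane → ℂ} (hf : MemLp f 2) (hg : MemLp g 2)
    (hh : MemLp h 2) {n : ℕ} (hn : MemLp (mollify n (fun x => f x + g x)) 2) :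
    l2 (fun x => mollify n (fun x => f x + g x) x - 2 * h x) ≤
      l2 (fun x => mollify n (fun x => f x + g x) x - (f x + g x)) +
        (l2 (fun x => f x - h x) + l2 (fun x => g x - h x)) := by
  have h1 := l2_add_le (hn.sub (hf.add hg)) ((hf.sub hh).add (hg.sub hh))
  have h2 := l2_add_le (hf.sub hh) (hg.sub hh)
  refine le_trans (le_of_eq ?_) (h1.trans (add_le_add le_rfl h2))
  congr 1
  ext x
  simp only [Pi.sub_apply, Pi.add_apply]
  ring

theorem HasWeakGradient.add_fun {f g : Plane → ℂ} {G H : Plane → EuclideanSpace ℂ (Fin 2)}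
    (h : HasWeakGradient f G) (k : HasWeakGradient g H) :
    HasWeakGradient (fun x => f x + g x) (fun x => G x + H x) := h.add k

theorem l2_fn_sub_le (g h : H1) : l2 (fun x => fn g x - fn h x) ≤ ‖g - h‖ := by
  rw [← l2_congr (fn_sub g h)]; exact l2_fn_le _

theorem l2_grad_coord_sub_le (g h : H1) (j : Fin 2) :
    l2 (fun x => grad g x j - grad h x j) ≤ ‖g - h‖ := by
  refine le_trans (le_of_eq (l2_congr ?_)) (l2_grad_coord_le (g - h) j)
  filter_upwards [grad_sub g h] with x hx
  rw [hx]; simp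

set_option maxHeartbeats 800000 in
/-- Over a time interval on which the solution varies little, the localised mass varies at most
at the rate given by the gradient of the cutoff. -/
theorem exists_abs_localMass_sub_le {p : ℝ} (hp : 0 < p) {a : Plane → ℝ} (ha : MemLp a ⊤)
    {u : ℝ → H1} (hu : IsSolution p a u) {K : ℝ} (hK : 0 ≤ K) (huK : ∀ t, ‖u t‖ ≤ K)
    {χ : Plane → ℝ} (hχ : IsTest χ) {L : ℝ} (hL : ∀ j x, ‖pd j χ x‖ ≤ L) :
    ∃ C : ℝ, 0 ≤ C ∧ ∀ s t ε : ℝ, s < t →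
      (∀ τ ∈ Set.Ioo s t, ‖u t - u τ‖ ≤ ε ∧ ‖u s - u τ‖ ≤ ε) →
      |localMass χ (u t) - localMass χ (u s)| ≤ (4 * L * K ^ 2 + C * (2 * ε)) * (t - s) := by
  obtain ⟨C, hC, H⟩ := exists_abs_flux_le hp ha hχ hL hK
  refine ⟨C, hC, fun s t ε hst hε => ?_⟩
  have ht := memLp_fn (u t)
  have hs := memLp_fn (u s)
  have hw := (hasWeakGradient_grad (u t)).add_fun (hasWeakGradient_grad (u s))
  have hts : MemLp (fun x => fn (u t) x + fn (u s) x) 2 := ht.add hs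
  set ψ : ℕ → Plane → ℂ := fun n => mollify n (fun x => fn (u t) x + fn (u s) x) with hψ
  have hψs : ∀ n, ContDiff ℝ ∞ (ψ n) := fun n => contDiff_mollify n hw.1
  have hpd : ∀ n j, pd j (ψ n) = mollify n (fun x => grad (u t) x j + grad (u s) x j) :=
    fun n j => funext fun x => pd_mollify n hw j x
  have hgj : ∀ j, MemLp (fun x => grad (u t) x j + grad (u s) x j) 2 := fun j =>
    (memLp_grad_coord (u t) j).add (memLp_grad_coord (u s) j)
  set e : ℕ → ℝ := fun n =>
    l2 (fun x => mollify n (fun x => fn (u t) x + fn (u s) x) x - (fn (u t) x + fn (u s) x)) +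
    ∑ j, l2 (fun x => mollify n (fun x => grad (u t) x j + grad (u s) x j) x -
      (grad (u t) x j + grad (u s) x j)) with he
  have he0 : Tendsto e atTop (𝓝 0) := by
    have := (tendsto_l2_mollify_sub hts).add
      (tendsto_finsetSum Finset.univ fun j _ => tendsto_l2_mollify_sub (hgj j))
    rwa [Finset.sum_const_zero, add_zero] at this
  have hlim : Tendsto (fun n => |(∫ x, (fn (u t) x - fn (u s) x) *
      ((χ x : ℂ) * star (ψ n x))).re|) atTop
      (𝓝 |localMass χ (u t) - localMass χ (u s)|) := by
    rw [← re_integral_sub_mul_star hχ]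
    exact ((Complex.continuous_re.tendsto _).comp
      (tendsto_integral_mul_mollify hχ (ht.sub hs) hts)).abs
  -- The mollification error `e n` disappears in the limit; the error `2ε` from the motion of `u` on
  -- the time interval remains.
  have hlim2 : Tendsto (fun n => (4 * L * K ^ 2 + C * (e n + 2 * ε)) * (t - s)) atTop
      (𝓝 ((4 * L * K ^ 2 + C * (0 + 2 * ε)) * (t - s))) :=
    ((((he0.add_const _).const_mul C).const_add _).mul_const _)
  rw [zero_add] at hlim2
  refine le_of_tendsto_of_tendsto hlim hlim2 ?_
  filter_upwards [eventually_memLp_mollify hts, eventually_memLp_mollify (hgj 0),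
    eventually_memLp_mollify (hgj 1)] with n hn hn0 hn1
  have hn' : ∀ j, MemLp (mollify n (fun x => grad (u t) x j + grad (u s) x j)) 2 := fun j => by
    fin_cases j
    · exact hn0
    · exact hn1
  set φ : Plane → ℂ := fun y => (χ y : ℂ) * star (ψ n y) with hφ
  have hφt : IsTest φ := isTest_cutoff_mul_conj hχ (hψs n)
  have hder := fun τ => hu.2 φ hφt τ
  have hder' : ∀ τ, HasDerivAt (fun s => (∫ x, fn (u s) x * φ x).re)
      (Complex.I * ((∫ x, fn (u τ) x * Laplacian.laplacian φ x) -
          ∫ x, nonlin p a (u τ) x * φ x)).re τ := fun τ =>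
    Complex.reCLM.hasFDerivAt.comp_hasDerivAt τ (hder τ)
  -- The test function is frozen while time varies, so the mean value theorem applies to the
  -- real-valued pairing.
  obtain ⟨τ, hτ, hmv⟩ := exists_hasDerivAt_eq_slope _ _ hst
    (fun x _ => (hder' x).continuousAt.continuousWithinAt) (fun x _ => hder' x)
  have hi : ∀ v : H1, Integrable (fun x => fn v x * φ x) := fun v => by
    have := (hasWeakGradient_grad v).1.integrable_smul_left_of_hasCompactSupport
      hφt.1.continuous hφt.2
    simpa [mul_comm] using this
  have hdiff : (∫ x, (fn (u t) x - fn (u s) x) * φ x).re =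
      (Complex.I * ((∫ x, fn (u τ) x * Laplacian.laplacian φ x) -
          ∫ x, nonlin p a (u τ) x * φ x)).re * (t - s) := by
    rw [hmv, div_mul_cancel₀ _ (sub_pos.2 hst).ne', ← Complex.sub_re,
      ← integral_sub (hi _) (hi _)]
    simp only [sub_mul]
  rw [hdiff, abs_mul, abs_of_pos (sub_pos.2 hst)]
  refine mul_le_mul_of_nonneg_right ?_ (sub_pos.2 hst).le
  obtain ⟨h1, h2⟩ := hε τ hτ
  have hsum : ∀ j, l2 (fun x => mollify n (fun x => grad (u t) x j + grad (u s) x j) x -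
      (grad (u t) x j + grad (u s) x j)) ≤ ∑ j, l2 (fun x => mollify n
      (fun x => grad (u t) x j + grad (u s) x j) x - (grad (u t) x j + grad (u s) x j)) :=
    fun j => Finset.single_le_sum (f := fun j => l2 (fun x => mollify n
      (fun x => grad (u t) x j + grad (u s) x j) x - (grad (u t) x j + grad (u s) x j)))
      (fun j _ => l2_nonneg _) (Finset.mem_univ j)
  have hpos : 0 ≤ l2 (fun x => mollify n (fun x => fn (u t) x + fn (u s) x) x -
    (fn (u t) x + fn (u s) x)) := l2_nonneg _
  refine H (u τ) (huK τ) (ψ n) (hψs n) hn (fun j => by rw [hpd]; exact hn' j) _ ?_ fun j => ?_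
  · refine (l2_mollify_sub_two_mul_le ht hs (memLp_fn (u τ)) hn).trans ?_
    have := l2_fn_sub_le (u t) (u τ)
    have := l2_fn_sub_le (u s) (u τ)
    have := (l2_nonneg _).trans (hsum 0)
    simp only [he]
    linarith
  · rw [hpd]
    refine (l2_mollify_sub_two_mul_le (memLp_grad_coord (u t) j) (memLp_grad_coord (u s) j)
      (memLp_grad_coord (u τ) j) (hn' j)).trans ?_
    have := l2_grad_coord_sub_le (u t) (u τ) j
    have := l2_grad_coord_sub_le (u s) (u τ) j
    have := hsum j
    simp only [he]
    linarith

theorem abs_localMass_sub_le {p : ℝ} (hp : 0 < p) {a : Plane → ℝ} (ha : MemLp a ⊤)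
    {u : ℝ → H1} (hu : IsSolution p a u) {K : ℝ} (hK : 0 ≤ K) (huK : ∀ t, ‖u t‖ ≤ K)
    {χ : Plane → ℝ} (hχ : IsTest χ) {L : ℝ} (hL : ∀ j x, ‖pd j χ x‖ ≤ L) {s t : ℝ}
    (hst : s ≤ t) :
    |localMass χ (u t) - localMass χ (u s)| ≤ 4 * L * K ^ 2 * (t - s) := by
  obtain ⟨C, hC, H⟩ := exists_abs_localMass_sub_le hp ha hu hK huK hχ hL
  refine abs_sub_le_of_locally_almost_lipschitz (F := fun t => localMass χ (u t))
    (fun t₀ ε hε => ?_) hst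
  -- Two times near `t₀` give values of `u` at distance at most twice this, and the estimate doubles
  -- it again: the error is `ε C / (C + 1) ≤ ε`.
  have hη : 0 < ε / (4 * (C + 1)) := by positivity
  obtain ⟨δ, hδ, hc⟩ := Metric.continuousAt_iff.1 (hu.1.continuousAt (x := t₀)) _ hη
  refine ⟨δ, hδ, fun s t hs ht hst => ?_⟩
  have hd : ∀ x y, |x - t₀| < δ → |y - t₀| < δ → ‖u x - u y‖ ≤ 2 * (ε / (4 * (C + 1))) := by
    intro x y hx hy
    have h1 := hc (x := x) (by rwa [Real.dist_eq])
    have h2 := hc (x := y) (by rwa [Real.dist_eq])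
    rw [← dist_eq_norm]
    have := dist_triangle_right (u x) (u y) (u t₀)
    linarith
  refine (H s t (2 * (ε / (4 * (C + 1)))) hst fun τ hτ => ?_).trans ?_
  · have hτ' : |τ - t₀| < δ := by
      rw [abs_lt] at hs ht ⊢
      constructor <;> linarith [hτ.1, hτ.2]
    exact ⟨hd t τ ht hτ', hd s τ hs hτ'⟩
  · refine mul_le_mul_of_nonneg_right ?_ (sub_pos.2 hst).le
    have : C * (2 * (2 * (ε / (4 * (C + 1))))) = ε * (C / (C + 1)) := by
      field_simp
      norm_num
    rw [this]
    have : C / (C + 1) ≤ 1 := by rw [div_le_one (by positivity)]; linarith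
    have := mul_le_mul_of_nonneg_left this hε.le
    linarith

/-! ### Conservation of mass -/

/-- Conservation of mass. -/
theorem l2_fn_eq {p : ℝ} (hp : 0 < p) {a : Plane → ℝ} (ha : MemLp a ⊤)
    {u : ℝ → H1} (hu : IsSolution p a u) {K : ℝ} (hK : 0 ≤ K) (huK : ∀ t, ‖u t‖ ≤ K)
    (s t : ℝ) : l2 (fn (u s)) = l2 (fn (u t)) := by
  wlog hst : s ≤ t generalizing s t
  · exact (this t s (le_of_not_ge hst)).symm
  let χ : ContDiffBump (0 : Plane) := ⟨1, 2, one_pos, one_lt_two⟩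
  have hχ : IsTest (χ : Plane → ℝ) := ⟨χ.contDiff, χ.hasCompactSupport⟩
  obtain ⟨L, hL⟩ := (hχ.2.fderiv ℝ).exists_bound_of_continuous
    (hχ.1.continuous_fderiv (by simp))
  set c : ℕ → ℝ := fun n => 1 / ((n : ℝ) + 1) with hc
  have hc0 : ∀ n, 0 < c n := fun n => by positivity
  have hclim : Tendsto c atTop (𝓝 0) := tendsto_one_div_add_atTop_nhds_zero_nat
  -- Spreading the cutoff out by the factor `n + 1` makes its gradient, and with it the mass flux,
  -- of size `O(1/n)`, while the localised mass tends to the full mass.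
  set η : ℕ → Plane → ℝ := fun n x => χ (c n • x) with hη
  have hηt : ∀ n, IsTest (η n) := fun n =>
    ⟨hχ.1.comp (contDiff_const_smul (c n)),
      hχ.2.comp_homeomorph (Homeomorph.smulOfNeZero (c n) (hc0 n).ne')⟩
  have hηL : ∀ n j x, ‖pd j (η n) x‖ ≤ c n * L := fun n j x => by
    have hd : HasFDerivAt (η n) _ x :=
      ((hχ.1.differentiable (by simp) (c n • x)).hasFDerivAt).comp x
        ((hasFDerivAt_id x).const_smul (c n))
    unfold pd
    rw [hd.fderiv]
    simp only [ContinuousLinearMap.comp_apply, smul_apply,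
      ContinuousLinearMap.id_apply, map_smul, norm_smul, Real.norm_of_nonneg (hc0 n).le]
    refine mul_le_mul_of_nonneg_left ?_ (hc0 n).le
    refine ((fderiv ℝ χ (c n • x)).le_opNorm _).trans ?_
    simpa using hL (c n • x)
  have hlim : ∀ v : H1, Tendsto (fun n => localMass (η n) v) atTop (𝓝 (l2 (fn v) ^ 2)) := by
    intro v
    rw [sq_l2 (memLp_fn v)]
    have hint : Integrable (fun x => ‖fn v x‖ ^ 2) :=
      (memLp_fn v).integrable_norm_pow (by norm_num)
    refine tendsto_integral_of_dominated_convergence (fun x => ‖fn v x‖ ^ 2)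
      (fun n => (hηt n).1.continuous.aestronglyMeasurable.mul hint.1) hint
      (fun n => Eventually.of_forall fun x => ?_) (Eventually.of_forall fun x => ?_)
    · rw [norm_mul, Real.norm_of_nonneg (by positivity : 0 ≤ ‖fn v x‖ ^ 2)]
      refine mul_le_of_le_one_left (by positivity) ?_
      simp only [hη]
      rw [Real.norm_of_nonneg χ.nonneg]
      exact χ.le_one
    · have h1 : Tendsto (fun n => η n x) atTop (𝓝 1) := by
        have h2 : Tendsto (fun n => χ (c n • x)) atTop (𝓝 (χ ((0 : ℝ) • x))) :=
          (χ.continuous.tendsto _).comp (hclim.smul_const x)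
        rwa [zero_smul, χ.one_of_mem_closedBall (by simp [χ])] at h2
      simpa using h1.mul_const (‖fn v x‖ ^ 2)
  have hbound : |l2 (fn (u t)) ^ 2 - l2 (fn (u s)) ^ 2| ≤ 0 := by
    have h1 : Tendsto (fun n => 4 * (c n * L) * K ^ 2 * (t - s)) atTop
        (𝓝 (4 * (0 * L) * K ^ 2 * (t - s))) :=
      (((hclim.mul_const L).const_mul 4).mul_const _).mul_const _
    rw [show 4 * (0 * L) * K ^ 2 * (t - s) = 0 by ring] at h1
    exact le_of_tendsto_of_tendsto' ((hlim (u t)).sub (hlim (u s))).abs h1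
      fun n => abs_localMass_sub_le hp ha hu hK huK (hηt n) (hηL n) hst
  have h2 : l2 (fn (u t)) ^ 2 = l2 (fn (u s)) ^ 2 :=
    sub_eq_zero.1 (abs_eq_zero.1 (le_antisymm hbound (abs_nonneg _)))
  exact ((sq_eq_sq₀ (l2_nonneg _) (l2_nonneg _)).1 h2).symm

/-- An element of `H1` is a pair, so its gradient component must vanish too; this follows by testing
it against every test function. -/
theorem eq_zero_of_fn_ae_eq_zero {g : H1} (h : fn g =ᵐ[volume] 0) : g = 0 := by
  have hw := hasWeakGradient_grad g
  have h1 : ∀ j, ∀ᵐ x, grad g x j = 0 := fun j => by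
    refine ae_eq_zero_of_integral_contDiff_smul_eq_zero (locallyIntegrable_coord hw.2.1 j)
      fun φ hφ hφc => ?_
    have h2 := hw.2.2 φ ⟨hφ, hφc⟩ j
    rw [integral_eq_zero_of_ae] at h2
    · exact neg_eq_zero.1 h2.symm
    · filter_upwards [h] with x hx
      simp [hx]
  have h2 : grad g =ᵐ[volume] 0 := by
    filter_upwards [h1 0, h1 1] with x h0 h1
    ext j
    fin_cases j
    · exact h0
    · exact h1
  have e1 : (g : L2Pair).fst = 0 := (Lp.eq_zero_iff_ae_eq_zero).2 h
  have e2 : (g : L2Pair).snd = 0 := (Lp.eq_zero_iff_ae_eq_zero).2 h2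
  refine Subtype.ext ((WithLp.equiv 2 _).injective (Prod.ext ?_ ?_))
  · exact e1
  · exact e2

/-! ### The kernel of `s x + 2i∇` -/

/-- The quadratic phase `exp (-i s |x|² / 4)`. -/
def phase (s : ℝ) (x : Plane) : ℂ := Complex.exp (-(Complex.I * s / 4) * ((‖x‖ ^ 2 : ℝ) : ℂ))

theorem norm_phase (s : ℝ) (x : Plane) : ‖phase s x‖ = 1 := by
  unfold phase
  rw [show -(Complex.I * s / 4) * ((‖x‖ ^ 2 : ℝ) : ℂ) =
    ((-(s / 4 * ‖x‖ ^ 2) : ℝ) : ℂ) * Complex.I by push_cast; ring]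
  exact Complex.norm_exp_ofReal_mul_I _

theorem contDiff_phase (s : ℝ) : ContDiff ℝ ∞ (phase s) :=
  (contDiff_const.mul (Complex.ofRealCLM.contDiff.comp (contDiff_norm_sq ℝ))).cexp

theorem pd_phase (s : ℝ) (j : Fin 2) (x : Plane) :
    pd j (phase s) x = -(Complex.I * s / 2) * x j * phase s x := by
  have h1 : HasFDerivAt (fun y : Plane => ‖y‖ ^ 2) (2 • innerSL ℝ x) x :=
    (hasStrictFDerivAt_norm_sq x).hasFDerivAt
  have h2 : HasFDerivAt (fun y : Plane => ((‖y‖ ^ 2 : ℝ) : ℂ))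
      (Complex.ofRealCLM.comp (2 • innerSL ℝ x)) x :=
    Complex.ofRealCLM.hasFDerivAt.comp x h1
  have h3 := ((h2.const_mul (-(Complex.I * s / 4))).cexp).fderiv
  unfold pd
  rw [show phase s = fun y : Plane =>
    Complex.exp (-(Complex.I * s / 4) * ((‖y‖ ^ 2 : ℝ) : ℂ)) from rfl, h3]
  simp [EuclideanSpace.inner_single_right]
  ring

/-- An `L²` function annihilated by `s x + 2 i ∇` vanishes. -/
theorem fn_ae_eq_zero_of_galilei (s : ℝ) (g : H1)
    (h : ∀ᵐ x : Plane, ∀ j, (s : ℂ) * x j * fn g x + 2 * Complex.I * grad g x j = 0) :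
    fn g =ᵐ[volume] 0 := by
  have hw := hasWeakGradient_grad g
  have hm : MemLp (fun x => phase s x * fn g x) 2 := by
    refine (memLp_fn g).of_le
      ((contDiff_phase s).continuous.aestronglyMeasurable.mul (memLp_fn g).1)
      (Eventually.of_forall fun x => ?_)
    rw [norm_mul, norm_phase, one_mul]
  -- The hypothesis reads `∇g = (is/2) x g`, and the gradient of the phase is `-(is/2) x` times the
  -- phase, so the two terms of the product rule cancel.
  have hz : HasWeakGradient (fun x => phase s x * fn g x) 0 := by
    refine ⟨hm.locallyIntegrable (by norm_num), locallyIntegrable_const 0, fun φ hφ j => ?_⟩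
    have hφc : ContDiff ℝ ∞ (fun x => (φ x : ℂ)) := Complex.ofRealCLM.contDiff.comp hφ.1
    have hφs : HasCompactSupport (fun x => (φ x : ℂ)) :=
      hφ.2.comp_left (g := fun r : ℝ => (r : ℂ)) (by simp)
    have hT : IsTest (fun x => (φ x : ℂ) * phase s x) :=
      ⟨hφc.mul (contDiff_phase s), hφs.mul_right⟩
    have h1 := hw.integral_pd_mul hT j
    have hpdφ : ∀ x, pd j (fun x => (φ x : ℂ)) x = ((pd j φ x : ℝ) : ℂ) := fun x => by
      have := (Complex.ofRealCLM.hasFDerivAt.comp x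
        (hφ.1.differentiable (by simp) x).hasFDerivAt).fderiv
      exact congrArg (fun L : Plane →L[ℝ] ℂ => L (EuclideanSpace.single j 1)) this
    have hpd : ∀ x, pd j (fun x => (φ x : ℂ) * phase s x) x =
        ((pd j φ x : ℝ) : ℂ) * phase s x + φ x * (-(Complex.I * s / 2) * x j * phase s x) :=
      fun x => by
        rw [pd_mul (hφc.differentiable (by simp) x)
          ((contDiff_phase s).differentiable (by simp) x), hpdφ, pd_phase]
    have i1 : Integrable (fun x => fn g x * (((pd j φ x : ℝ) : ℂ) * phase s x)) := by
      have := hφ.integrable_fderiv_smul (EuclideanSpace.single j 1)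
        (hm.locallyIntegrable (by norm_num))
      refine this.congr (Eventually.of_forall fun x => ?_)
      simp only [Complex.real_smul, pd]
      ring
    have i2 : Integrable (fun x => grad g x j * (φ x * phase s x)) := by
      have := (locallyIntegrable_coord hw.2.1 j).integrable_smul_left_of_hasCompactSupport
        hT.1.continuous hT.2
      simpa [mul_comm] using this
    have e : (fun x => fn g x * pd j (fun x => (φ x : ℂ) * phase s x) x) =ᵐ[volume]
        fun x => fn g x * (((pd j φ x : ℝ) : ℂ) * phase s x) -
          grad g x j * (φ x * phase s x) := by
      filter_upwards [h] with x hx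
      rw [hpd]
      have h2 : grad g x j = Complex.I * s / 2 * x j * fn g x := by
        linear_combination (-Complex.I / 2) * hx j + grad g x j * Complex.I_sq
      rw [h2]; ring
    rw [integral_congr_ae e, integral_sub i1 i2, sub_eq_neg_self] at h1
    simp only [Pi.zero_apply, PiLp.zero_apply, smul_zero, integral_zero, neg_zero]
    rw [← h1]
    refine integral_congr_ae (Eventually.of_forall fun x => ?_)
    simp only [Complex.real_smul, pd]
    ring
  filter_upwards [hz.ae_eq_zero hm] with x hx
  have : phase s x ≠ 0 := by rw [← norm_ne_zero_iff, norm_phase]; exact one_ne_zero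
  simpa [this] using hx

/-! ### The rescaled norm and its continuity up to infinite time -/

/-- The weight `(4 + |x|³)^{-1/2}`. -/
def weight (x : Plane) : ℝ := (Real.sqrt (4 + ‖x‖ ^ 3))⁻¹

theorem weight_pos (x : Plane) : 0 < weight x := by
  unfold weight; positivity

theorem weight_le_one (x : Plane) : weight x ≤ 1 := by
  refine inv_le_one_of_one_le₀ ?_
  rw [Real.one_le_sqrt]
  have : 0 ≤ ‖x‖ ^ 3 := by positivity
  linarith

/-- Because `|x|² ≤ 4 + |x|³`. Multiplication by the weighted `x` is therefore bounded on `L²`, and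
no spatial decay of the solution is needed. -/
theorem weight_mul_norm_le_one (x : Plane) : weight x * ‖x‖ ≤ 1 := by
  have hx := norm_nonneg x
  unfold weight
  rw [inv_mul_le_one₀ (by positivity)]
  refine Real.le_sqrt_of_sq_le ?_
  nlinarith [mul_nonneg hx (sq_nonneg (‖x‖ - 1)), sq_nonneg (‖x‖ - 1)]

theorem continuous_weight : Continuous weight := by
  unfold weight
  refine Continuous.inv₀ (by fun_prop) fun x => ?_
  positivity

/-- The field `s x g + 2 i ∇g`, that is `s (x + 2 i t ∇) g` with `s = 1 / t`. -/
def rescaledGalilei (s : ℝ) (g : H1) (x : Plane) : EuclideanSpace ℂ (Fin 2) :=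
  WithLp.toLp 2 fun j => (s : ℂ) * x j * fn g x + 2 * Complex.I * grad g x j

/-- The embedding of the real plane into the complex one. -/
def complexify (x : Plane) : EuclideanSpace ℂ (Fin 2) := WithLp.toLp 2 fun j => (x j : ℂ)

theorem norm_complexify (x : Plane) : ‖complexify x‖ = ‖x‖ := by
  rw [EuclideanSpace.norm_eq, EuclideanSpace.norm_eq]
  simp [complexify]

theorem continuous_complexify : Continuous complexify := by
  unfold complexify
  refine (PiLp.continuous_toLp 2 _).comp (continuous_pi fun j => ?_)
  fun_prop

theorem rescaledGalilei_eq (s : ℝ) (g : H1) (x : Plane) :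
    rescaledGalilei s g x =
      ((s : ℂ) * fn g x) • complexify x + (2 * Complex.I) • grad g x := by
  ext j
  simp [rescaledGalilei, complexify]
  ring

/-- A lower bound for the `Z(t)` norm, with `s = 1 / t`, that is continuous up to `s = 0`. -/
def rescaledNorm (s : ℝ) (g : H1) : ℝ≥0∞ :=
  eLpNorm (fun x => weight x • rescaledGalilei s g x) 2 volume

theorem aestronglyMeasurable_rescaled (s : ℝ) (g : H1) :
    AEStronglyMeasurable (fun x => weight x • rescaledGalilei s g x) volume := by
  simp only [rescaledGalilei_eq]
  exact continuous_weight.aestronglyMeasurable.smul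
    (((aestronglyMeasurable_const.mul (memLp_fn g).1).smul
      continuous_complexify.aestronglyMeasurable).add ((memLp_grad g).1.fun_const_smul _))

/-- For `t ≥ 1`, both `⟨t⟩³ ≤ 4t³` and `|x|³ ≤ t³|x|³`, so the denominator is at most `t^{3/2} (4 +
|x|³)^{1/2}`. The power `t^{3/2}` cancels against `t^{1/2}` and the `t` taken out of `x + 2it∇`. -/
theorem rescaledNorm_le {t : ℝ} (ht : 1 ≤ t) (g : H1) : rescaledNorm (1 / t) g ≤ zNorm t g := by
  refine eLpNorm_mono fun x => ?_
  have ht0 : 0 < t := by linarith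
  have e : rescaledGalilei (1 / t) g x = ((1 / t : ℝ) : ℂ) • galilei t g x := by
    ext j
    have : (t : ℂ) ≠ 0 := by exact_mod_cast ht0.ne'
    simp [rescaledGalilei, galilei]
    field_simp
  rw [e, norm_smul, norm_smul, norm_smul, ← mul_assoc]
  refine mul_le_mul_of_nonneg_right ?_ (norm_nonneg _)
  rw [Complex.norm_real, Real.norm_of_nonneg (weight_pos x).le,
    Real.norm_of_nonneg (by positivity), Real.norm_of_nonneg (by positivity)]
  have hb : bracket t ^ 3 ≤ 4 * t ^ 3 := by
    have h0 : 0 ≤ bracket t := Real.sqrt_nonneg _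
    have h1 : bracket t ^ 2 = 1 + t ^ 2 := Real.sq_sqrt (by positivity)
    have h2 : bracket t ≤ 2 * t := by
      refine Real.sqrt_le_iff.2 ⟨by linarith, by nlinarith⟩
    calc bracket t ^ 3 = (1 + t ^ 2) * bracket t := by rw [← h1]; ring
      _ ≤ (2 * t ^ 2) * (2 * t) := by gcongr; nlinarith
      _ = 4 * t ^ 3 := by ring
  have hbp : 0 < bracket t ^ 3 + ‖x‖ ^ 3 := by
    have : 0 < bracket t := Real.sqrt_pos.2 (by positivity)
    positivity
  have hx : (0 : ℝ) ≤ ‖x‖ ^ 3 := by positivity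
  have h3 : (1 : ℝ) ≤ t ^ 3 := one_le_pow₀ ht
  have key : Real.sqrt (bracket t ^ 3 + ‖x‖ ^ 3) ≤
      Real.sqrt t * t * Real.sqrt (4 + ‖x‖ ^ 3) := by
    have h4 : Real.sqrt t * t * Real.sqrt (4 + ‖x‖ ^ 3) = Real.sqrt (t ^ 3 * (4 + ‖x‖ ^ 3)) := by
      rw [Real.sqrt_mul (by positivity), show t ^ 3 = t * t ^ 2 by ring,
        Real.sqrt_mul ht0.le, Real.sqrt_sq ht0.le]
    rw [h4]
    refine Real.sqrt_le_sqrt ?_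
    nlinarith
  unfold weight
  rw [← div_eq_inv_mul, div_div, div_le_div_iff₀ (by positivity) (by positivity)]
  calc _ = Real.sqrt (bracket t ^ 3 + ‖x‖ ^ 3) := one_mul _
    _ ≤ _ := key
    _ = _ := by ring

/-- Split `s x g - s' x g'` as `(s - s') x g + s' x (g - g')`. The factor `3` is one for the second
term, as `|s'| ≤ 1`, plus two for `2i∇(g - g')`. -/
theorem rescaledNorm_le_add {s s' : ℝ} (hs' : |s'| ≤ 1) (g g' : H1) :
    rescaledNorm s g ≤ rescaledNorm s' g' +
      (ENNReal.ofReal |s - s'| * ENNReal.ofReal ‖g‖ + 3 * ENNReal.ofReal ‖g - g'‖) := by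
  have h1 : eLpNorm (fun x => weight x • rescaledGalilei s g x -
      weight x • rescaledGalilei s' g' x) 2 volume ≤
      ENNReal.ofReal |s - s'| * ENNReal.ofReal ‖g‖ + 3 * ENNReal.ofReal ‖g - g'‖ := by
    have hb : ∀ᵐ x, ‖weight x • rescaledGalilei s g x - weight x • rescaledGalilei s' g' x‖ ≤
        ‖|s - s'| * ‖fn g x‖ + (‖fn (g - g') x‖ + 2 * ‖grad (g - g') x‖)‖ := by
      filter_upwards [fn_sub g g', grad_sub g g'] with x h1 h2
      rw [h1, h2, Real.norm_of_nonneg (by positivity)]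
      have e : weight x • rescaledGalilei s g x - weight x • rescaledGalilei s' g' x =
          (((s - s' : ℝ) : ℂ) * fn g x) • (weight x • complexify x) +
          ((((s' : ℝ) : ℂ) * (fn g x - fn g' x)) • (weight x • complexify x) +
          weight x • ((2 * Complex.I) • (grad g x - grad g' x))) := by
        rw [rescaledGalilei_eq, rescaledGalilei_eq]
        ext j
        simp
        ring
      have hc : ‖weight x • complexify x‖ ≤ 1 := by
        rw [norm_smul, norm_complexify, Real.norm_of_nonneg (weight_pos x).le]
        exact weight_mul_norm_le_one x
      rw [e]
      refine (norm_add_le _ _).trans (add_le_add ?_ ((norm_add_le _ _).trans (add_le_add ?_ ?_)))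
      · rw [norm_smul, norm_mul, Complex.norm_real, Real.norm_eq_abs]
        exact mul_le_of_le_one_right (by positivity) hc
      · rw [norm_smul, norm_mul, Complex.norm_real, Real.norm_eq_abs]
        refine (mul_le_of_le_one_right (by positivity) hc).trans ?_
        exact mul_le_of_le_one_left (norm_nonneg _) hs'
      · rw [norm_smul, norm_smul, Real.norm_of_nonneg (weight_pos x).le]
        simp only [norm_mul, Complex.norm_ofNat, Complex.norm_I, mul_one]
        exact mul_le_of_le_one_left (by positivity) (weight_le_one x)
    have m1 := (memLp_fn g).1.norm
    have m2 := (memLp_fn (g - g')).1.norm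
    have m3 := (memLp_grad (g - g')).1.norm
    have c1 : ∀ (c : ℝ) (f : Plane → ℝ),
        eLpNorm (fun x => c * f x) 2 volume = ENNReal.ofReal |c| * eLpNorm f 2 volume :=
      fun c f => by
        rw [← Real.norm_eq_abs, ofReal_norm]
        exact eLpNorm_const_smul c f 2 volume
    refine (eLpNorm_mono_ae hb).trans ?_
    refine (eLpNorm_add_le (m1.const_mul _) (m2.add (m3.const_mul _)) (by norm_num)).trans ?_
    refine add_le_add ?_ ?_
    · rw [c1, eLpNorm_norm, abs_abs]
      gcongr
      exact eLpNorm_fn_le g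
    · refine (eLpNorm_add_le m2 (m3.const_mul _) (by norm_num)).trans ?_
      rw [c1, eLpNorm_norm, eLpNorm_norm,
        show (3 : ℝ≥0∞) * ENNReal.ofReal ‖g - g'‖ =
          ENNReal.ofReal ‖g - g'‖ + 2 * ENNReal.ofReal ‖g - g'‖ by ring]
      have : ENNReal.ofReal |(2 : ℝ)| = 2 := by norm_num
      rw [this]
      gcongr
      · exact eLpNorm_fn_le _
      · exact eLpNorm_grad_le _
  refine le_trans ?_ (add_le_add le_rfl h1)
  have h2 := eLpNorm_add_le (aestronglyMeasurable_rescaled s' g')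
    ((aestronglyMeasurable_rescaled s g).sub (aestronglyMeasurable_rescaled s' g'))
    (p := 2) (by norm_num)
  refine le_trans (le_of_eq ?_) h2
  unfold rescaledNorm
  congr 1
  ext x
  simp

theorem fn_ae_eq_zero_of_rescaledNorm {s : ℝ} {g : H1} (h : rescaledNorm s g = 0) :
    fn g =ᵐ[volume] 0 := by
  refine fn_ae_eq_zero_of_galilei s g ?_
  have h1 := (eLpNorm_eq_zero_iff (aestronglyMeasurable_rescaled s g) (by norm_num)).1 h
  filter_upwards [h1] with x hx j
  have h2 : rescaledGalilei s g x = 0 :=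
    (smul_eq_zero.1 hx).resolve_left (weight_pos x).ne'
  exact congrArg (fun v : EuclideanSpace ℂ (Fin 2) => v j) h2

/-! ### Compactness and divergence of the Morawetz integral -/

/-- On a pre-compact orbit along which the mass is a positive constant, the `Z(t)` norm is bounded
below. -/
theorem iInf_zNorm_pos {u : ℝ → H1} (hcpt : HasPrecompactOrbit u) {m : ℝ} (hm : 0 < m)
    (hu : ∀ t, l2 (fn (u t)) = m) : 0 < ⨅ t : Set.Ici (1 : ℝ), zNorm t (u t) := by
  by_contra hcon
  have h0 : (⨅ t : Set.Ici (1 : ℝ), zNorm t (u t)) = 0 := by simpa using hcon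
  have h1 : ∀ n : ℕ, ∃ t : ℝ, 1 ≤ t ∧ zNorm t (u t) < ((n : ℝ≥0∞) + 1)⁻¹ := fun n => by
    have : (⨅ t : Set.Ici (1 : ℝ), zNorm t (u t)) < ((n : ℝ≥0∞) + 1)⁻¹ := by
      rw [h0]
      exact ENNReal.inv_pos.2 (by finiteness)
    obtain ⟨t, ht⟩ := iInf_lt_iff.1 this
    exact ⟨t, t.2, ht⟩
  choose t ht1 ht using h1
  -- The variable `1/t` compactifies `[1, ∞)`; the added endpoint `0` covers times escaping to
  -- infinity.
  have hK : IsCompact (Set.Icc (0 : ℝ) 1 ×ˢ closure (Set.range u)) := isCompact_Icc.prod hcpt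
  have hmem : ∀ n, (1 / t n, u (t n)) ∈ Set.Icc (0 : ℝ) 1 ×ˢ closure (Set.range u) := fun n =>
    ⟨⟨by have := ht1 n; positivity, by rw [div_le_one (by linarith [ht1 n])]; exact ht1 n⟩,
      subset_closure ⟨_, rfl⟩⟩
  obtain ⟨⟨s, g⟩, -, k, hk, hlim⟩ := hK.tendsto_subseq hmem
  have hs : Tendsto (fun n => 1 / t (k n)) atTop (𝓝 s) :=
    (continuous_fst.tendsto _).comp hlim
  have hg : Tendsto (fun n => u (t (k n))) atTop (𝓝 g) :=
    (continuous_snd.tendsto _).comp hlim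
  have hg' : Tendsto (fun n => ‖g - u (t (k n))‖) atTop (𝓝 0) := by
    simpa using ((tendsto_const_nhds (x := g)).sub hg).norm
  have hs' : Tendsto (fun n => |s - 1 / t (k n)|) atTop (𝓝 0) := by
    simpa using ((tendsto_const_nhds (x := s)).sub hs).abs
  have hinv : Tendsto (fun n : ℕ => ((k n : ℝ≥0∞) + 1)⁻¹) atTop (𝓝 0) := by
    have h2 : Tendsto (fun n : ℕ => ((n : ℝ≥0∞) + 1)⁻¹) atTop (𝓝 0) := by
      have := (ENNReal.tendsto_inv_nat_nhds_zero).comp (tendsto_add_atTop_nat 1)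
      simpa [Function.comp_def] using this
    exact h2.comp hk.tendsto_atTop
  have hz : rescaledNorm s g = 0 := by
    have hb : Tendsto (fun n => ((k n : ℝ≥0∞) + 1)⁻¹ +
        (ENNReal.ofReal |s - 1 / t (k n)| * ENNReal.ofReal ‖g‖ +
          3 * ENNReal.ofReal ‖g - u (t (k n))‖)) atTop
        (𝓝 (0 + (ENNReal.ofReal 0 * ENNReal.ofReal ‖g‖ + 3 * ENNReal.ofReal 0))) :=
      hinv.add ((ENNReal.Tendsto.mul_const (ENNReal.tendsto_ofReal hs')
        (Or.inr ENNReal.ofReal_ne_top)).add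
        (ENNReal.Tendsto.const_mul (ENNReal.tendsto_ofReal hg') (Or.inr ENNReal.ofNat_ne_top)))
    simp only [ENNReal.ofReal_zero, zero_mul, mul_zero, add_zero] at hb
    refine le_antisymm (ge_of_tendsto' hb fun n => ?_) bot_le
    have h3 := (hmem (k n)).1
    refine (rescaledNorm_le_add (s' := 1 / t (k n)) ?_ g (u (t (k n)))).trans
      (add_le_add ((rescaledNorm_le (ht1 _) _).trans (ht _).le) le_rfl)
    rw [abs_of_nonneg h3.1]
    exact h3.2
  have hfz : l2 (fn g) = 0 := by
    rw [l2_congr (fn_ae_eq_zero_of_rescaledNorm hz)]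
    simp [l2]
  -- The limit has zero mass and the orbit has mass norm `m`, so they stay at distance at least `m`,
  -- against the convergence.
  have hle : ∀ n, m ≤ ‖g - u (t (k n))‖ := fun n => by
    have h2 := l2_add_le (memLp_fn g) ((memLp_fn (u (t (k n)))).sub (memLp_fn g))
    simp only [Pi.sub_apply, add_sub_cancel] at h2
    have h3 := l2_fn_sub_le (u (t (k n))) g
    rw [norm_sub_rev] at h3
    have h4 := hu (t (k n))
    have h5 : l2 (fn (u (t (k n))) - fn g) = l2 (fun x => fn (u (t (k n))) x - fn g x) := rfl
    have h6 : l2 (fun x => fn (u (t (k n))) x) = m := h4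
    linarith
  exact absurd (ge_of_tendsto' hg' hle) (not_le.2 hm)

/-- The integrand is at least a positive constant times `1/t`, whose integral diverges
logarithmically. -/
theorem lintegral_sq_div_eq_top {f : ℝ → ℝ≥0∞}
    (h : 0 < ⨅ t : Set.Ici (1 : ℝ), f t) :
    ∫⁻ t in Set.Ici (1 : ℝ), f t ^ 2 / ENNReal.ofReal t = ⊤ := by
  obtain ⟨c, hc0, hc⟩ := exists_between h
  have h1 : ∫⁻ t in Set.Ici (1 : ℝ), ENNReal.ofReal t⁻¹ = ⊤ := by
    by_contra hne
    refine not_integrableOn_Ici_inv (a := (1 : ℝ)) ⟨by fun_prop, ?_⟩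
    rw [hasFiniteIntegral_iff_ofReal]
    · exact lt_top_iff_ne_top.2 hne
    · filter_upwards [ae_restrict_mem measurableSet_Ici] with t ht
      exact inv_nonneg.2 (zero_le_one.trans ht)
  have h2 : ∫⁻ t in Set.Ici (1 : ℝ), c ^ 2 * ENNReal.ofReal t⁻¹ = ⊤ := by
    rw [lintegral_const_mul _ (by fun_prop), h1]
    exact ENNReal.mul_top (pow_ne_zero 2 hc0.ne')
  refine top_unique (h2.symm.le.trans ?_)
  refine setLIntegral_mono' measurableSet_Ici fun t ht => ?_
  rw [ENNReal.ofReal_inv_of_pos (zero_lt_one.trans_le ht), ← div_eq_mul_inv]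
  gcongr
  exact hc.le.trans (iInf_le (fun t : Set.Ici (1 : ℝ) => f t) ⟨t, ht⟩)

end NLS

end

theorem mainTheorem8 (p : ℝ) (hp : 0 < p) (a : NLS.Plane → ℝ) (ha : NLS.Admissible p a)
    (u : ℝ → NLS.H1) (hu : NLS.IsSolution p a u) (hcpt : NLS.HasPrecompactOrbit u)
    (hne : u ≠ 0) :
    0 < (⨅ t : Set.Ici (1 : ℝ), NLS.zNorm t (u t)) ∧
      ∫⁻ t in Set.Ici (1 : ℝ), NLS.zNorm t (u t) ^ 2 / ENNReal.ofReal t = ⊤ := by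
  obtain ⟨K, hK⟩ := hcpt.isBounded.exists_norm_le
  have huK : ∀ t, ‖u t‖ ≤ K := fun t => hK _ (subset_closure ⟨t, rfl⟩)
  have hK0 : 0 ≤ K := (norm_nonneg _).trans (huK 0)
  have hmass : ∀ t, NLS.l2 (NLS.fn (u t)) = NLS.l2 (NLS.fn (u 0)) := fun t =>
    NLS.l2_fn_eq hp ha.memLp_top hu hK0 huK t 0
  have hpos : 0 < NLS.l2 (NLS.fn (u 0)) := by
    -- Zero mass at time `0` would propagate to all times by conservation and force `u = 0`.
    refine lt_of_le_of_ne (NLS.l2_nonneg _) fun h0 => hne (funext fun t => ?_)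
    have h1 : (eLpNorm (NLS.fn (u t)) 2 volume).toReal = 0 := (hmass t).trans h0.symm
    have h2 := NLS.memLp_fn (u t)
    exact NLS.eq_zero_of_fn_ae_eq_zero ((eLpNorm_eq_zero_iff h2.1 (by norm_num)).1
      (((ENNReal.toReal_eq_zero_iff _).1 h1).resolve_right h2.2.ne))
  have hinf := NLS.iInf_zNorm_pos hcpt hpos hmass
  exact ⟨hinf, NLS.lintegral_sq_div_eq_top (f := fun t => NLS.zNorm t (u t)) hinf⟩
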